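/- **Corollary (BoundedGraphSearch runs in $(b+1)$-ExpTime).** *Setting.* Fix finite sets of agents and atoms. Formulas are built from $\top$, atoms, $\neg$, $\wedge$ and $\Box_i$; $\mathit{md}(\varphi)$ is the modal depth. A state $s$ is a finite pointed Kripke model $((W,R,L),w_d)$; an action $\alpha$ is a finite pointed event model $((E,Q,\mathit{pre},\mathit{post}),e_d)$ whose preconditions $\mathit{pre}(e)$ and postconditions $\mathit{post}(e)(q)$ ($q$ an atom) are formulas, and $\mathit{md}(\alpha)$ is the largest modal depth among them. $\alpha$ is applicable in $s$ if $s\models \mathit{pre}(e_d)$; then $s\otimes\alpha$ is the product update: its worlds are the pairs $(w,e)$ with $w\models\mathit{pre}(e)$, its relations are the componentwise ones, $q$ holds at $(w,e)$ iff $w\models\mathit{post}(e)(q)$, and the designated world is $(w_d,e_d)$. A planning task is $T=(s_0,\mathcal A,\varphi_g)$ with a state $s_0$, a finite list $\mathcal A$ of actions and a goal formula $\varphi_g$. Its size $|T|$ is the number of agents and atoms, plus the numbers of worlds, events, edges and (world, true atom) pairs, plus the lengths of all formulas. *Canonical contraction.* Let $d(w)$ be the distance of $w$ from $w_d$ and $b(w)=b-d(w)$.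 The $h$-signature of $w$ is $\sigma_0(w)=L(w)$, $\sigma_{h+1}(w)=(L(w),\,i\mapsto\{\sigma_h(v) : wR_iv\})$. A world $x$ with $b(x)\ge 0$ is maximal if no $y$ with $b(y)>b(x)$ is $b(x)$-bisimilar to $x$. The canonical $b$-contraction $\langle s\rangle_b$ has as worlds the signatures $\sigma_{b(x)}(x)$ of the maximal worlds $x$, with the label of $x$, numbered by decreasing $b(x)$ and then lexicographically, the designated world being $\sigma_b(w_d)$. If $x$ is maximal with $b(x)>0$ and $xR_iz$, there is an $i$-edge from $\sigma_{b(x)}(x)$ to the first $\sigma_{b(y)}(y)$, $y$ maximal, such that $b(y)\ge b(x)-1$ and $y$ is $(b(x)-1)$-bisimilar to $z$; there are no other edges. *Algorithm.* $\textsc{InitNode}(s,b,f)$ is the node $(\langle s\rangle_b,\,b,\,f')$ where $f'$ is true iff $f$ is true and $\langle s\rangle_b$ is bisimilar to $s$. $\textsc{BoundedGraphSearch}(T,b)$ starts with a queue containing only $\textsc{InitNode}(s_0,b,\mathit{true})$. It repeatedly removes the first node $(s,k,f)$ of the queue; if $s\models\varphi_g$, it returns the sequence of actions that led to this node; otherwise,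 for each $\alpha\in\mathcal A$ that is applicable in $s$ and satisfies $\mathit{md}(\alpha)\le k$, it computes the child node, which is $\textsc{InitNode}(s\otimes\alpha,k,\mathit{true})$ if $f$ is true, $\textsc{InitNode}(s\otimes\alpha,k-\mathit{md}(\alpha),\mathit{false})$ if $f$ is false and $k-\mathit{md}(\alpha)\ge\mathit{md}(\varphi_g)$, and undefined otherwise. A child node is appended to the queue unless it is superfluous in view of an earlier generated node. If the queue is empty, it reports failure. A node $(s',k',f')$ is superfluous in view of $(s,k,f)$ if $s=s'$ and, according to one of three variants of the algorithm: no further condition; or $k'\le k$ and ($f$ or not $f'$); or $k'=k$ and $f'=f$. Running time is the number of elementary steps on a unit-cost random access machine, all subroutines included: model checking by evaluating all subformulas at all worlds; product update by enumerating pairs; ($h$-)bisimilarity by iterated refinement of tables; signatures by recursion on $h$, with sets of signatures kept as sorted lists; distances by rounds of propagation; state comparison entry by entry. *Statement.* For each of the three variants and each fixed $b\in\mathbb N$, $\textsc{BoundedGraphSearch}(\cdot,b)$ runs in $(b+1)$-fold exponential time: there is a polynomial $q$ such that for every planning task $T$, the algorithm on input $(T,b)$ halts after at most $\exp_2^{b+1}(q(|T|))$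 steps, where $\exp_2^{k}(x)$ is the iterated exponential $2^{2^{\cdot^{\cdot^{2^{x}}}}}$ with $k$ twos. -/

import Mathlib

namespace DEL

/-! ## Step counting

A program is a value together with the number of elementary steps spent on computing it, on a
random access machine with unit-cost words: `Timed.op` is one elementary operation (read of a
memory cell, comparison or Boolean operation on words, allocation of a list cell or a record).
Fixed-length arrays are functions on `Fin n`; a read is one operation, and filling an array costs
one step per cell plus the cost of computing the cells. Every function below is assembled from
these operations by sequencing and recursion. -/

structure Timed (α : Type) where
  val : α
  time : ℕ

namespace Timed

variable {α β : Type}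

instance : Monad Timed where
  pure x := ⟨x, 0⟩
  bind x f := ⟨(f x.val).val, x.time + (f x.val).time⟩

/-- One elementary operation. -/
def op (x : α) : Timed α := ⟨x, 1⟩

/-- Allocate an array of length `n` and fill its cells one after the other. -/
def tab (n : ℕ) (f : Fin n → Timed α) : Timed (Fin n → α) :=
  ⟨fun i => (f i).val, 1 + ∑ i, ((f i).time + 1)⟩

/-- Copy a list into an array. -/
def toArr (l : List α) : Timed (Fin l.length → α) := ⟨l.get, l.length + 1⟩

/-- Loop over a list: does the test succeed for some element? -/
def any : List α → (α → Timed Bool) → Timed Bool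
  | [], _ => op false
  | x :: l, f => do
    let c ← f x
    let r ← any l f
    op (c || r)

/-- Loop over a list: does the test succeed for all elements? -/
def all : List α → (α → Timed Bool) → Timed Bool
  | [], _ => op true
  | x :: l, f => do
    let c ← f x
    let r ← all l f
    op (c && r)

/-- The elements of a list that pass the test. -/
def filter : List α → (α → Timed Bool) → Timed (List α)
  | [], _ => op []
  | x :: l, f => do
    let c ← f x
    let r ← filter l f
    op (if c then x :: r else r)

/-- The first element of a list that passes the test. -/
def find : List α → (α → Timed Bool) → Timed (Option α)
  | [], _ => op none
  | x :: l, f => do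
    let c ← f x
    if c then op (some x) else find l f

/-- Apply a program to all elements of a list. -/
def collect : List α → (α → Timed β) → Timed (List β)
  | [], _ => op []
  | x :: l, f => do
    let y ← f x
    let r ← collect l f
    op (y :: r)

/-- Largest value of a program on a list (`0` for the empty list). -/
def maxOf : List α → (α → Timed ℕ) → Timed ℕ
  | [], _ => op 0
  | x :: l, f => do
    let y ← f x
    let r ← maxOf l f
    op (max y r)

def append : List α → List α → Timed (List α)
  | [], m => op m
  | x :: l, m => do
    let r ← append l m
    op (x :: r)

/-- `reverseOnto l m` is the reversal of `l` followed by `m`. -/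
def reverseOnto : List α → List α → Timed (List α)
  | [], m => op m
  | x :: l, m => do
    let m' ← op (x :: m)
    reverseOnto l m'

/-- Lexicographic comparison of lists. -/
def cmpList (c : α → α → Timed Ordering) : List α → List α → Timed Ordering
  | [], [] => op .eq
  | [], _ :: _ => op .lt
  | _ :: _, [] => op .gt
  | x :: l, y :: m => do
    match ← c x y with
    | .lt => op .lt
    | .gt => op .gt
    | .eq => cmpList c l m

/-- Insert into an increasing list, unless an equal element is there. -/
def insert (c : α → α → Timed Ordering) (x : α) : List α → Timed (List α)
  | [] => op [x]
  | y :: l => do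
    match ← c x y with
    | .lt => op (x :: y :: l)
    | .eq => op (y :: l)
    | .gt => do
      let r ← insert c x l
      op (y :: r)

/-- Insertion sort that removes duplicates. -/
def sort (c : α → α → Timed Ordering) : List α → Timed (List α)
  | [] => op []
  | x :: l => do
    let r ← sort c l
    insert c x r

@[simp] theorem val_pure (x : α) : (pure x : Timed α).val = x := rfl
@[simp] theorem val_bind (x : Timed α) (f : α → Timed β) : (x >>= f).val = (f x.val).val := rfl
@[simp] theorem val_op (x : α) : (op x).val = x := rfl
@[simp] theorem val_tab (n : ℕ) (f : Fin n → Timed α) : (tab n f).val = fun i => (f i).val := rfl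

@[simp] theorem val_any (l : List α) (f : α → Timed Bool) :
    (any l f).val = l.any fun x => (f x).val := by
  induction l with
  | nil => rfl
  | cons x l ih => simp [any, ih]

@[simp] theorem val_all (l : List α) (f : α → Timed Bool) :
    (all l f).val = l.all fun x => (f x).val := by
  induction l with
  | nil => rfl
  | cons x l ih => simp [all, ih]

end Timed

open Timed

/-! ## Epistemic logic -/

/-- Epistemic formulas over `a` agents and `p` atoms. -/
inductive Fml (a p : ℕ) : Type
  | top : Fml a p
  | atom (q : Fin p) : Fml a p
  | neg (φ : Fml a p) : Fml a p
  | and (φ ψ : Fml a p) : Fml a p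
  | box (i : Fin a) (φ : Fml a p) : Fml a p

/-- Finite pointed Kripke models (epistemic states). -/
structure State (a p : ℕ) : Type where
  /-- number of worlds -/
  n : ℕ
  /-- accessibility relation of each agent -/
  rel : Fin a → Fin n → Fin n → Bool
  /-- the atoms true at each world -/
  lab : Fin n → Fin p → Bool
  /-- the designated world -/
  pt : Fin n

/-- Finite pointed event models (epistemic actions) with pre- and postconditions. The atom `q`
holds after the event `e` iff `post e q` holds before it. -/
structure Action (a p : ℕ) : Type where
  /-- number of events -/
  m : ℕ
  rel : Fin a → Fin m → Fin m → Bool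
  pre : Fin m → Fml a p
  post : Fin m → Fin p → Fml a p
  /-- the designated event -/
  pt : Fin m

/-- An epistemic planning task `(s₀, 𝒜, φ_g)`. -/
structure Task : Type where
  /-- number of agents -/
  a : ℕ
  /-- number of atoms -/
  p : ℕ
  init : State a p
  actions : List (Action a p)
  goal : Fml a p

/-- Length of a formula. -/
def Fml.size {a p : ℕ} : Fml a p → ℕ
  | .top => 1
  | .atom _ => 1
  | .neg φ => φ.size + 1
  | .and φ ψ => φ.size + ψ.size + 1
  | .box _ φ => φ.size + 1

/-- Number of worlds, edges and (world, true atom) pairs. -/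
def State.size {a p : ℕ} (s : State a p) : ℕ :=
  s.n + (Finset.univ.filter fun x : Fin a × Fin s.n × Fin s.n => s.rel x.1 x.2.1 x.2.2).card
    + (Finset.univ.filter fun x : Fin s.n × Fin p => s.lab x.1 x.2).card

/-- Number of events and edges plus the lengths of all pre- and postconditions. -/
def Action.size {a p : ℕ} (α : Action a p) : ℕ :=
  α.m + (Finset.univ.filter fun x : Fin a × Fin α.m × Fin α.m => α.rel x.1 x.2.1 x.2.2).card
    + ∑ e, ((α.pre e).size + ∑ q, (α.post e q).size)

/-- The size `|T|` of a planning task. -/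
def Task.size (T : Task) : ℕ :=
  T.a + T.p + T.init.size + (T.actions.map Action.size).sum + T.goal.size

/-- Truth of a formula at a world. -/
def Fml.Sat {a p : ℕ} (s : State a p) : Fml a p → Fin s.n → Prop
  | .top, _ => True
  | .atom q, w => s.lab w q = true
  | .neg φ, w => ¬ φ.Sat s w
  | .and φ ψ, w => φ.Sat s w ∧ ψ.Sat s w
  | .box i φ, w => ∀ v, s.rel i w v = true → φ.Sat s v

/-- Model checking: the truth values of a formula at all worlds. -/
def Fml.check {a p : ℕ} (s : State a p) : Fml a p → Timed (Fin s.n → Bool)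
  | .top => tab s.n fun _ => op true
  | .atom q => tab s.n fun w => op (s.lab w q)
  | .neg φ => do
    let x ← φ.check s
    tab s.n fun w => op (!x w)
  | .and φ ψ => do
    let x ← φ.check s
    let y ← ψ.check s
    tab s.n fun w => op (x w && y w)
  | .box i φ => do
    let x ← φ.check s
    tab s.n fun w => all (List.finRange s.n) fun v => op (!s.rel i w v || x v)

theorem Fml.check_iff {a p : ℕ} (s : State a p) (φ : Fml a p) (w : Fin s.n) :
    (φ.check s).val w = true ↔ φ.Sat s w := by
  induction φ generalizing w with
  | top => simp [check, Sat]
  | atom q => simp [check, Sat]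
  | neg φ ih => simp [check, Sat, ← ih]
  | and φ ψ ih ih' => simp [check, Sat, ih, ih']
  | box i φ ih =>
    simp only [check, Sat, val_bind, val_tab, val_all, val_op, List.all_eq_true,
      List.mem_finRange, true_imp_iff, ← ih]
    exact forall_congr' fun v => by cases s.rel i w v <;> simp

/-- Modal depth of a formula. -/
def Fml.depth {a p : ℕ} : Fml a p → Timed ℕ
  | .top => op 0
  | .atom _ => op 0
  | .neg φ => do
    let d ← φ.depth
    op d
  | .and φ ψ => do
    let d ← φ.depth
    let d' ← ψ.depth
    op (max d d')
  | .box _ φ => do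
    let d ← φ.depth
    op (d + 1)

/-- Modal depth of an action: the largest modal depth of its pre- and postconditions. -/
def Action.depth {a p : ℕ} (α : Action a p) : Timed ℕ :=
  maxOf (List.finRange α.m) fun e => do
    let d ← (α.pre e).depth
    let d' ← maxOf (List.finRange p) fun q => (α.post e q).depth
    op (max d d')

/-- Is the action applicable in the state: does the precondition of the designated event hold at
the designated world? -/
def applicable {a p : ℕ} (s : State a p) (α : Action a p) : Timed Bool := do
  let x ← (α.pre α.pt).check s
  op (x s.pt)

/-- Product update `s ⊗ α` (for an applicable action). Its worlds are the pairs `(w, e)` such that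
`w` satisfies the precondition of `e`; the designated pair is listed first. -/
def update {a p : ℕ} (s : State a p) (α : Action a p) : Timed (State a p) := do
  let pre ← tab α.m fun e => (α.pre e).check s
  let post ← tab α.m fun e => tab p fun q => (α.post e q).check s
  let rest ← filter ((List.finRange s.n).product (List.finRange α.m)) fun x =>
    op (pre x.2 x.1 && !(x.1 == s.pt && x.2 == α.pt))
  let ws ← toArr ((s.pt, α.pt) :: rest)
  let rel ← tab a fun i => tab (rest.length + 1) fun j => tab (rest.length + 1) fun k =>
    op (s.rel i (ws j).1 (ws k).1 && α.rel i (ws j).2 (ws k).2)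
  let lab ← tab (rest.length + 1) fun j => tab p fun q => op (post (ws j).2 q (ws j).1)
  op { n := rest.length + 1, rel := rel, lab := lab, pt := 0 }

/-! ## Bisimulation -/

/-- `h`-bisimilarity of worlds. -/
def HBisim {a p : ℕ} (s t : State a p) : ℕ → Fin s.n → Fin t.n → Prop
  | 0, u, v => s.lab u = t.lab v
  | h + 1, u, v => s.lab u = t.lab v ∧
      (∀ i u', s.rel i u u' = true → ∃ v', t.rel i v v' = true ∧ HBisim s t h u' v') ∧
      (∀ i v', t.rel i v v' = true → ∃ u', s.rel i u u' = true ∧ HBisim s t h u' v')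

/-- Bisimilarity of states. -/
def Bisim {a p : ℕ} (s t : State a p) : Prop :=
  ∃ Z : Fin s.n → Fin t.n → Prop, Z s.pt t.pt ∧ ∀ u v, Z u v → s.lab u = t.lab v ∧
    (∀ i u', s.rel i u u' = true → ∃ v', t.rel i v v' = true ∧ Z u' v') ∧
    (∀ i v', t.rel i v v' = true → ∃ u', s.rel i u u' = true ∧ Z u' v')

/-- The table of `h`-bisimilarity between the worlds of two states, by `h` refinement rounds. -/
def refine {a p : ℕ} (s t : State a p) : ℕ → Timed (Fin s.n → Fin t.n → Bool)
  | 0 => tab s.n fun u => tab t.n fun v =>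
      all (List.finRange p) fun q => op (s.lab u q == t.lab v q)
  | h + 1 => do
    let Z ← refine s t h
    tab s.n fun u => tab t.n fun v => do
      let forth ← all (List.finRange a) fun i => all (List.finRange s.n) fun u' => do
        let r ← any (List.finRange t.n) fun v' => op (t.rel i v v' && Z u' v')
        op (!s.rel i u u' || r)
      let back ← all (List.finRange a) fun i => all (List.finRange t.n) fun v' => do
        let r ← any (List.finRange s.n) fun u' => op (s.rel i u u' && Z u' v')
        op (!t.rel i v v' || r)
      op (Z u v && forth && back)

/-- Bisimilarity test: as there are `s.n * t.n` pairs of worlds, the refinement is stable after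
that many rounds. -/
def bisimTest {a p : ℕ} (s t : State a p) : Timed Bool := do
  let Z ← refine s t (s.n * t.n)
  op (Z s.pt t.pt)

theorem HBisim.pred {a p : ℕ} {s t : State a p} : ∀ {h : ℕ} {u : Fin s.n} {v : Fin t.n},
    HBisim s t (h + 1) u v → HBisim s t h u v
  | 0, _, _, H => H.1
  | h + 1, _, _, H => ⟨H.1,
      fun i u' hu => (H.2.1 i u' hu).imp fun _ hv => ⟨hv.1, hv.2.pred⟩,
      fun i v' hv => (H.2.2 i v' hv).imp fun _ hu => ⟨hu.1, hu.2.pred⟩⟩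

theorem refine_iff {a p : ℕ} (s t : State a p) (h : ℕ) (u : Fin s.n) (v : Fin t.n) :
    (refine s t h).val u v = true ↔ HBisim s t h u v := by
  induction h generalizing u v with
  | zero => simp [refine, HBisim, funext_iff]
  | succ h ih =>
    have key : HBisim s t (h + 1) u v ↔ HBisim s t h u v ∧
        (∀ i u', s.rel i u u' = true → ∃ v', t.rel i v v' = true ∧ HBisim s t h u' v') ∧
        (∀ i v', t.rel i v v' = true → ∃ u', s.rel i u u' = true ∧ HBisim s t h u' v') := by
      refine ⟨fun H => ⟨H.pred, H.2⟩, fun H => ⟨?_, H.2⟩⟩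
      cases h with
      | zero => exact H.1
      | succ h => exact H.1.1
    rw [key]
    simp only [refine, val_bind, val_tab, val_all, val_any, val_op, Bool.and_eq_true, ih,
      List.all_eq_true, List.any_eq_true, List.mem_finRange, true_imp_iff, true_and,
      Bool.or_eq_true, Bool.not_eq_true', and_assoc, ← Bool.not_eq_true, ← imp_iff_not_or]

theorem bisimTest_iff {a p : ℕ} (s t : State a p) :
    (bisimTest s t).val = true ↔ Bisim s t := by
  classical
  simp only [bisimTest, val_bind, val_op, refine_iff]
  constructor
  · intro H
    let F : ℕ → Finset (Fin s.n × Fin t.n) := fun h =>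
      Finset.univ.filter fun x => HBisim s t h x.1 x.2
    have hF : ∀ h, F (h + 1) ⊆ F h := fun h x hx => by
      simp only [F, Finset.mem_filter, Finset.mem_univ, true_and] at hx ⊢
      exact hx.pred
    have hN : ∃ h ≤ s.n * t.n, F (h + 1) = F h := by
      by_contra! hne
      have hc : ∀ h ≤ s.n * t.n + 1, (F h).card + h ≤ s.n * t.n := by
        intro h
        induction h with
        | zero =>
          intro _
          simpa using Finset.card_le_univ (F 0)
        | succ h ih =>
          intro hh
          have h1 := ih (by omega)
          have h2 : (F (h + 1)).card < (F h).card :=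
            Finset.card_lt_card ((hF h).ssubset_of_ne (hne h (by omega)))
          omega
      have := hc _ le_rfl
      omega
    obtain ⟨h, hle, heq⟩ := hN
    have hmono : ∀ k l, k ≤ l → F l ⊆ F k := fun k l hkl =>
      antitone_nat_of_succ_le hF hkl
    have hst : ∀ u v, HBisim s t h u v → HBisim s t (h + 1) u v := fun u v huv => by
      have : (u, v) ∈ F (h + 1) := by
        rw [heq]
        simpa [F] using huv
      simpa [F] using this
    refine ⟨HBisim s t h, ?_, fun u v huv => hst u v huv⟩
    have : (s.pt, t.pt) ∈ F h := hmono _ _ hle (by simpa [F] using H)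
    simpa [F] using this
  · rintro ⟨Z, h0, hZ⟩
    have : ∀ h u v, Z u v → HBisim s t h u v := by
      intro h
      induction h with
      | zero => exact fun u v huv => (hZ u v huv).1
      | succ h ih =>
        intro u v huv
        obtain ⟨h1, h2, h3⟩ := hZ u v huv
        exact ⟨h1, fun i u' hu => (h2 i u' hu).imp fun _ hv => ⟨hv.1, ih _ _ hv.2⟩,
          fun i v' hv => (h3 i v' hv).imp fun _ hu => ⟨hu.1, ih _ _ hu.2⟩⟩
    exact this _ _ _ h0

/-! ## Signatures and canonical contractions -/

/-- `h`-signatures: the label of a world and, if `h > 0`, for each agent a finite set of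
`(h-1)`-signatures, represented by its increasing enumeration. -/
def Sig : ℕ → Type
  | 0 => List Bool
  | h + 1 => List Bool × List (List (Sig h))

def cmpBool (x y : Bool) : Timed Ordering := op (compare x y)

/-- A linear order on `h`-signatures (lexicographic). -/
def Sig.cmp : (h : ℕ) → Sig h → Sig h → Timed Ordering
  | 0 => fun (x y : List Bool) => cmpList cmpBool x y
  | h + 1 => fun (x y : List Bool × List (List (Sig h))) => do
    match ← cmpList cmpBool x.1 y.1 with
    | .lt => op .lt
    | .gt => op .gt
    | .eq => cmpList (cmpList (Sig.cmp h)) x.2 y.2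

/-- The `h`-signatures of all worlds: `σ₀(w) = L(w)` and
`σ_{h+1}(w) = (L(w), i ↦ {σ_h(v) | w R_i v})`. -/
def sig {a p : ℕ} (s : State a p) : (h : ℕ) → Timed (Fin s.n → Sig h)
  | 0 => tab s.n fun w =>
      (collect (List.finRange p) fun q => op (s.lab w q) : Timed (List Bool))
  | h + 1 => do
    let σ ← sig s h
    tab s.n fun w => do
      let l ← collect (List.finRange p) fun q => op (s.lab w q)
      let r ← collect (List.finRange a) fun i => do
        let vs ← filter (List.finRange s.n) fun v => op (s.rel i w v)
        let xs ← collect vs fun v => op (σ v)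
        sort (Sig.cmp h) xs
      (op (l, r) : Timed (List Bool × List (List (Sig h))))

/-- After `r` rounds: the bounds `b(w) = b - d(w)` of the worlds `w` whose distance `d(w)` from the
designated world is at most `r`; `none` for the other worlds. -/
def boundsUpTo {a p : ℕ} (s : State a p) (b : ℕ) : ℕ → Timed (Fin s.n → Option (Fin (b + 1)))
  | 0 => tab s.n fun w => op (if w = s.pt then some (Fin.last b) else none)
  | r + 1 => do
    let d ← boundsUpTo s b r
    tab s.n fun w => do
      let hit ← any (List.finRange a) fun i => any (List.finRange s.n) fun v =>
        op ((d v).isSome && s.rel i v w)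
      op (if (d w).isSome then d w else
        if hit then some ⟨b - (r + 1), by omega⟩ else none)

/-- The representatives of the bounds `k - 1, …, 0`: for each of these bounds (in decreasing order)
and each signature `σ_{b(x)}(x)` of a maximal world `x` of that bound (in increasing order), one
such world. -/
def repsBelow {a p b : ℕ} (s : State a p) (d : Fin s.n → Option (Fin (b + 1)))
    (maximal : Fin s.n → Bool) : ℕ → Timed (List (Fin s.n))
  | 0 => op []
  | k + 1 => do
    let σ ← sig s k
    let xs ← filter (List.finRange s.n) fun x => op (maximal x && (d x).map Fin.val == some k)
    let ys ← sort (fun x y => Sig.cmp k (σ x) (σ y)) xs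
    let zs ← repsBelow s d maximal k
    append ys zs

/-- The canonical `b`-contraction of `s`. A world `y` represents `x` if `b(y) ≥ b(x) ≥ 0` and `y` is
`b(x)`-bisimilar to `x`; `x` is maximal if it is not represented by a world of larger bound. The
worlds of the contraction are the signatures `σ_{b(x)}(x)` of the maximal worlds `x`, numbered by
decreasing bound and then by the order of signatures (the only world of bound `b` is the designated
one, which gets number `0`). If `x R_i z` and `b(x) > 0`, there is an `i`-edge from `σ_{b(x)}(x)` to
the least `σ_{b(y)}(y)` such that `b(y) ≥ b(x) - 1` and `y` is `(b(x)-1)`-bisimilar to `z`. -/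
def contract {a p : ℕ} (s : State a p) (b : ℕ) : Timed (State a p) := do
  let d ← boundsUpTo s b b
  let bis ← tab (b + 1) fun h => refine s s h
  let maximal ← tab s.n fun x => do
    let r ← any (List.finRange s.n) fun y => op (match d x, d y with
      | some k, some l => decide (k < l) && bis k y x
      | _, _ => false)
    op ((d x).isSome && !r)
  let rest ← repsBelow s d maximal b
  let ws ← toArr (s.pt :: rest)
  let rel ← tab a fun i => tab (rest.length + 1) fun j => tab (rest.length + 1) fun j' =>
    any (List.finRange s.n) fun z => do
      let y ← find (List.finRange (rest.length + 1)) fun y => op (match d (ws j), d (ws y) with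
        | some k, some l => decide (0 < k.val ∧ k.val ≤ l.val + 1) &&
            bis ⟨k.val - 1, by omega⟩ (ws y) z
        | _, _ => false)
      op (s.rel i (ws j) z && y == some j')
  let lab ← tab (rest.length + 1) fun j => tab p fun q => op (s.lab (ws j) q)
  op { n := rest.length + 1, rel := rel, lab := lab, pt := 0 }

/-- Are two states (given by tables) identical? -/
def sameState {a p : ℕ} (s t : State a p) : Timed Bool :=
  if h : s.n = t.n then do
    let x ← all (List.finRange a) fun i => all (List.finRange s.n) fun u =>
      all (List.finRange s.n) fun v => op (s.rel i u v == t.rel i (u.cast h) (v.cast h))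
    let y ← all (List.finRange s.n) fun u => all (List.finRange p) fun q =>
      op (s.lab u q == t.lab (u.cast h) q)
    op (x && y && s.pt.cast h == t.pt)
  else op false

/-! ## The search -/

/-- Nodes of the search tree. `plan` lists the actions on the path from the root, last one first. -/
structure Node (a p : ℕ) : Type where
  state : State a p
  bound : ℕ
  isBisim : Bool
  plan : List (Action a p)

def initNode {a p : ℕ} (s : State a p) (b : ℕ) (wasBisim : Bool) (plan : List (Action a p)) :
    Timed (Node a p) := do
  let s' ← contract s b
  let c ← if wasBisim then bisimTest s' s else op false
  op { state := s', bound := b, isBisim := c, plan := plan }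

/-- `dg` is the modal depth of the goal, `none` stands for failure. -/
def childNode {a p : ℕ} (N : Node a p) (α : Action a p) (dg : ℕ) : Timed (Option (Node a p)) := do
  let dα ← α.depth
  if N.isBisim then do
    let s ← update N.state α
    let N' ← initNode s N.bound true (α :: N.plan)
    op (some N')
  else if dα + dg ≤ N.bound then do
    let s ← update N.state α
    let N' ← initNode s (N.bound - dα) false (α :: N.plan)
    op (some N')
  else op none

/-- Which earlier nodes with the same contracted state make a new node superfluous: all of them;
those whose bound and flag are at least as good; those with the same bound and flag. -/
inductive DuplicateRule : Type
  | sameState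
  | dominated
  | sameNode

/-- Is the new node `N'` superfluous in view of the earlier node `N`? -/
def DuplicateRule.covers {a p : ℕ} (ρ : DuplicateRule) (N N' : Node a p) : Timed Bool := do
  let x ← Timed.op (match ρ with
    | .sameState => true
    | .dominated => decide (N'.bound ≤ N.bound) && (N.isBisim || !N'.isBisim)
    | .sameNode => decide (N'.bound = N.bound) && N'.isBisim == N.isBisim)
  if x then DEL.sameState N.state N'.state else op false

/-- The queue of nodes to be expanded, and all nodes generated so far. -/
structure Config (a p : ℕ) : Type where
  frontier : List (Node a p)
  generated : List (Node a p)

/-- Expansion of a node: for each action that is applicable in its state and whose modal depth does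
not exceed its bound, compute the child node; unless it is superfluous, put it at the end of the
queue. -/
def expand {a p : ℕ} (ρ : DuplicateRule) (dg : ℕ) (N : Node a p) :
    List (Action a p) → Config a p → Timed (Config a p)
  | [], c => op c
  | α :: l, c => do
    let dα ← α.depth
    let ok ← if dα ≤ N.bound then applicable N.state α else op false
    if ok then do
      match ← childNode N α dg with
      | none => expand ρ dg N l c
      | some N' => do
        let dup ← any c.generated fun M => ρ.covers M N'
        if dup then expand ρ dg N l c
        else do
          let f ← append c.frontier [N']
          let c' ← op { frontier := f, generated := N' :: c.generated }
          expand ρ dg N l c'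
    else expand ρ dg N l c

/-- One round of the main loop. It ends the search (`Sum.inl`) with a plan or with failure (`none`),
or yields the next configuration (`Sum.inr`). -/
def step (T : Task) (ρ : DuplicateRule) (c : Config T.a T.p) :
    Timed (Option (List (Action T.a T.p)) ⊕ Config T.a T.p) :=
  match c.frontier with
  | [] => op (.inl none)
  | N :: f => do
    let x ← T.goal.check N.state
    if x N.state.pt then do
      let π ← reverseOnto N.plan []
      op (.inl (some π))
    else do
      let dg ← T.goal.depth
      let c' ← expand ρ dg N T.actions { c with frontier := f }
      op (.inr c')

/-- `Loop T ρ c r t`: from the configuration `c` the main loop ends with the result `r` after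
exactly `t` elementary steps. -/
inductive Loop (T : Task) (ρ : DuplicateRule) :
    Config T.a T.p → Option (List (Action T.a T.p)) → ℕ → Prop
  | halt {c : Config T.a T.p} {r : Option (List (Action T.a T.p))} :
      (step T ρ c).val = .inl r → Loop T ρ c r (step T ρ c).time
  | next {c c' : Config T.a T.p} {r : Option (List (Action T.a T.p))} {t : ℕ} :
      (step T ρ c).val = .inr c' → Loop T ρ c' r t → Loop T ρ c r ((step T ρ c).time + t)

/-- `BoundedGraphSearch ρ T b r t`: on input `(T, b)` bounded graph search ends with the result `r`
(a plan, or `none` for failure) after exactly `t` elementary steps. -/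
def BoundedGraphSearch (ρ : DuplicateRule) (T : Task) (b : ℕ)
    (r : Option (List (Action T.a T.p))) (t : ℕ) : Prop :=
  ∃ t', Loop T ρ ⟨[(initNode T.init b true []).val], [(initNode T.init b true []).val]⟩ r t' ∧
    t = (initNode T.init b true []).time + t'

/-- Iterated exponential `2^(2^(⋯^(2^x)))` with `k` twos. -/
def tower : ℕ → ℕ → ℕ
  | 0, x => x
  | k + 1, x => 2 ^ tower k x

/-- `k`-fold exponential time: on each input the algorithm halts, within `tower k (q (size))` steps
for a fixed polynomial `q`. `Halts x t` says that the run on input `x` ends after `t` steps. -/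
def RunsInExpTime {I : Type} (k : ℕ) (size : I → ℕ) (Halts : I → ℕ → Prop) : Prop :=
  ∃ q : Polynomial ℕ, ∀ x, ∃ t, Halts x t ∧ t ≤ tower k (q.eval (size x))

end DEL

/-!
Bounded graph search halts because the states that it stores are canonical contractions, and these
have a number of worlds that depends only on the numbers `a` of agents and `p` of atoms and on the
bound `b`. Apart from the designated world, the worlds of a `b`-contraction are distinct signatures
of depth less than `b`. There are `2 ^ p` signatures of depth `0` and `2 ^ p * (2 ^ A) ^ a`
signatures of depth `h + 1` if there are `A` of depth `h` (`sigCard`), each level adding one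
exponential, so that a `b`-contraction has at most `b`-fold exponentially many worlds
(`n_contract_le`, `worldBound_le`). That the algorithm indeed keeps no more worlds than this rests
on two facts: its comparison of signatures is a linear order (`Sig.transCmp`, `Sig.lawfulEqCmp`), so
the sorted list without repetitions that represents a set depends only on this set (`sort_congr`);
and the worlds of a state can be given `sigCard a p h` codes such that worlds with equal codes have
equal `h`-signatures (`exists_code`).

A state with `W` worlds is a table of `a * W * W + p * W` bits with a designated world, so there are
`(b + 1)`-fold exponentially many nodes, up to the plans they carry (`nodeBound_le`). Each of the
three duplicate rules rejects at least the nodes that agree with an earlier one up to the plan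
(`DuplicateRule.covers_of_eq`). Hence at most `nodeBound` nodes are generated, and as each iteration
removes one node from the queue, the main loop ends (`exists_loop`).

For the running time, let `X ≥ 2` dominate all data that occur: the size of the task, the number of
worlds of a product update of a contraction, and the number of nodes. All subroutines are loops
whose length is polynomial in `X`, nested to a depth that depends on `b` only, so each of them takes
at most `X ^ k` steps for some `k` depending on `b` (`Within`), and so does the whole search
(`exists_boundedGraphSearch`). One may take `X = 2 ^ u ^ 7` where `u` is `b`-fold exponential in a
polynomial of the size of the task. Raising an iterated exponential to a fixed power only replaces
its argument by a power (`tower_pow_le`), so `X ^ k` is `(b + 1)`-fold exponential.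
-/

namespace DEL

open Timed

/-! ### Cost bounds -/

/-- The program takes at most `X ^ k` elementary steps. All costs are expressed as powers of one
base `X ≥ 2` that dominates the sizes of all data, so that loops and sequencing only increase the
exponent by a constant. The exponents below are not optimal. -/
def Within (X k : ℕ) {α : Type} (t : Timed α) : Prop := t.time ≤ X ^ k

section Arithmetic

variable {X : ℕ}

theorem pow_add_pow_le (hX : 2 ≤ X) (k l : ℕ) : X ^ k + X ^ l ≤ X ^ (max k l + 1) := by
  have h1 : X ^ k ≤ X ^ max k l := Nat.pow_le_pow_right (by omega) (le_max_left _ _)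
  have h2 : X ^ l ≤ X ^ max k l := Nat.pow_le_pow_right (by omega) (le_max_right _ _)
  have h3 : X ^ max k l * 2 ≤ X ^ max k l * X := Nat.mul_le_mul_left _ hX
  rw [pow_succ]
  omega

/-- A loop with at most `X` iterations of cost at most `X ^ k`, and a constant overhead, raises the
exponent by at most three. -/
theorem loop_le_pow (hX : 2 ≤ X) {n k t : ℕ} (hn : n ≤ X) (ht : t ≤ n * (X ^ k + 1) + 1) :
    t ≤ X ^ (k + 3) := by
  have h1 : 1 ≤ X ^ k := Nat.one_le_pow _ _ (by omega)
  have h2 : n * (X ^ k + 1) ≤ X * (X ^ k + 1) := Nat.mul_le_mul_right _ hn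
  have h3 : X * (X ^ k + 1) + 1 ≤ X * (2 * X ^ k) + X * X ^ k := by nlinarith
  have h4 : X ^ (k + 3) = X * X ^ k * (X * X) := by ring
  have h5 : 4 ≤ X * X := by nlinarith
  rw [h4]
  nlinarith [Nat.mul_le_mul_left (X * X ^ k) h5]

end Arithmetic

namespace Within

variable {α β : Type} {X k l : ℕ}

theorem mono (hX : 2 ≤ X) {t : Timed α} (h : Within X k t) (hkl : k ≤ l) : Within X l t :=
  h.trans (Nat.pow_le_pow_right (by omega) hkl)

theorem op (hX : 2 ≤ X) (x : α) : Within X k (Timed.op x) :=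
  Nat.one_le_pow _ _ (by omega)

theorem bind (hX : 2 ≤ X) {x : Timed α} {f : α → Timed β} (hx : Within X k x)
    (hf : Within X l (f x.val)) : Within X (max k l + 1) (x >>= f) :=
  (Nat.add_le_add hx hf).trans (pow_add_pow_le hX k l)

theorem ite {c : Prop} [Decidable c] {x y : Timed α} (hX : 2 ≤ X) (hx : Within X k x)
    (hy : Within X l y) : Within X (max k l) (if c then x else y) := by
  split
  · exact hx.mono hX (le_max_left _ _)
  · exact hy.mono hX (le_max_right _ _)

theorem tab (hX : 2 ≤ X) {n : ℕ} (hn : n ≤ X) {f : Fin n → Timed α}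
    (hf : ∀ i, Within X k (f i)) : Within X (k + 3) (Timed.tab n f) := by
  refine loop_le_pow hX hn ?_
  have : ∑ i, ((f i).time + 1) ≤ ∑ _i : Fin n, (X ^ k + 1) :=
    Finset.sum_le_sum fun i _ => Nat.add_le_add_right (hf i) 1
  simp only [Finset.sum_const, Finset.card_univ, Fintype.card_fin, smul_eq_mul] at this
  simp only [Timed.tab]
  omega

theorem toArr (hX : 2 ≤ X) {l : List α} (hl : l.length ≤ X) : Within X 3 (Timed.toArr l) := by
  refine loop_le_pow (k := 0) hX hl ?_
  simp only [Timed.toArr, pow_zero]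
  omega

theorem any (hX : 2 ≤ X) {l : List α} {f : α → Timed Bool} (hl : l.length ≤ X)
    (hf : ∀ x ∈ l, Within X k (f x)) : Within X (k + 3) (Timed.any l f) := by
  refine loop_le_pow hX hl ?_
  clear hl
  induction l with
  | nil => simp [Timed.any, Timed.op]
  | cons x l ih =>
    have h1 := ih fun y hy => hf y (List.mem_cons_of_mem _ hy)
    have h2 : (f x).time ≤ X ^ k := hf x List.mem_cons_self
    have h3 : (Timed.any (x :: l) f).time = (f x).time + ((Timed.any l f).time + 1) := rfl
    rw [h3, List.length_cons, add_mul]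
    omega

theorem all (hX : 2 ≤ X) {l : List α} {f : α → Timed Bool} (hl : l.length ≤ X)
    (hf : ∀ x ∈ l, Within X k (f x)) : Within X (k + 3) (Timed.all l f) := by
  refine loop_le_pow hX hl ?_
  clear hl
  induction l with
  | nil => simp [Timed.all, Timed.op]
  | cons x l ih =>
    have h1 := ih fun y hy => hf y (List.mem_cons_of_mem _ hy)
    have h2 : (f x).time ≤ X ^ k := hf x List.mem_cons_self
    have h3 : (Timed.all (x :: l) f).time = (f x).time + ((Timed.all l f).time + 1) := rfl
    rw [h3, List.length_cons, add_mul]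
    omega

theorem filter (hX : 2 ≤ X) {l : List α} {f : α → Timed Bool} (hl : l.length ≤ X)
    (hf : ∀ x ∈ l, Within X k (f x)) : Within X (k + 3) (Timed.filter l f) := by
  refine loop_le_pow hX hl ?_
  clear hl
  induction l with
  | nil => simp [Timed.filter, Timed.op]
  | cons x l ih =>
    have h1 := ih fun y hy => hf y (List.mem_cons_of_mem _ hy)
    have h2 : (f x).time ≤ X ^ k := hf x List.mem_cons_self
    have h3 : (Timed.filter (x :: l) f).time = (f x).time + ((Timed.filter l f).time + 1) := rfl
    rw [h3, List.length_cons, add_mul]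
    omega

theorem collect (hX : 2 ≤ X) {l : List α} {f : α → Timed β} (hl : l.length ≤ X)
    (hf : ∀ x ∈ l, Within X k (f x)) : Within X (k + 3) (Timed.collect l f) := by
  refine loop_le_pow hX hl ?_
  clear hl
  induction l with
  | nil => simp [Timed.collect, Timed.op]
  | cons x l ih =>
    have h1 := ih fun y hy => hf y (List.mem_cons_of_mem _ hy)
    have h2 : (f x).time ≤ X ^ k := hf x List.mem_cons_self
    have h3 : (Timed.collect (x :: l) f).time = (f x).time + ((Timed.collect l f).time + 1) := rfl
    rw [h3, List.length_cons, add_mul]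
    omega

theorem maxOf (hX : 2 ≤ X) {l : List α} {f : α → Timed ℕ} (hl : l.length ≤ X)
    (hf : ∀ x ∈ l, Within X k (f x)) : Within X (k + 3) (Timed.maxOf l f) := by
  refine loop_le_pow hX hl ?_
  clear hl
  induction l with
  | nil => simp [Timed.maxOf, Timed.op]
  | cons x l ih =>
    have h1 := ih fun y hy => hf y (List.mem_cons_of_mem _ hy)
    have h2 : (f x).time ≤ X ^ k := hf x List.mem_cons_self
    have h3 : (Timed.maxOf (x :: l) f).time = (f x).time + ((Timed.maxOf l f).time + 1) := rfl
    rw [h3, List.length_cons, add_mul]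
    omega

theorem find (hX : 2 ≤ X) {l : List α} {f : α → Timed Bool} (hl : l.length ≤ X)
    (hf : ∀ x ∈ l, Within X k (f x)) : Within X (k + 3) (Timed.find l f) := by
  refine loop_le_pow hX hl ?_
  clear hl
  induction l with
  | nil => simp [Timed.find, Timed.op]
  | cons x l ih =>
    have h1 := ih fun y hy => hf y (List.mem_cons_of_mem _ hy)
    have h2 : (f x).time ≤ X ^ k := hf x List.mem_cons_self
    have h3 : (Timed.find (x :: l) f).time ≤ (f x).time + ((Timed.find l f).time + 1) := by
      change (f x).time + (if (f x).val then Timed.op (some x) else Timed.find l f).time ≤ _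
      split
      · simp [Timed.op]
      · omega
    rw [List.length_cons, add_mul]
    omega

theorem append (hX : 2 ≤ X) {l m : List α} (hl : l.length ≤ X) :
    Within X 3 (Timed.append l m) := by
  refine loop_le_pow (k := 0) hX hl ?_
  clear hl
  induction l with
  | nil => simp [Timed.append, Timed.op]
  | cons x l ih =>
    have h3 : (Timed.append (x :: l) m).time = (Timed.append l m).time + 1 := rfl
    rw [h3, List.length_cons, add_mul]
    omega

theorem reverseOnto (hX : 2 ≤ X) {l m : List α} (hl : l.length ≤ X) :
    Within X 3 (Timed.reverseOnto l m) := by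
  refine loop_le_pow (k := 0) hX hl ?_
  clear hl
  induction l generalizing m with
  | nil => simp [Timed.reverseOnto, Timed.op]
  | cons x l ih =>
    have h3 : (Timed.reverseOnto (x :: l) m).time
        = 1 + (Timed.reverseOnto l (x :: m)).time := rfl
    have h4 := ih (m := x :: m)
    rw [h3, List.length_cons, add_mul]
    omega

theorem cmpList (hX : 2 ≤ X) {c : α → α → Timed Ordering} {l m : List α} (hl : l.length ≤ X)
    (hc : ∀ x ∈ l, ∀ y ∈ m, Within X k (c x y)) : Within X (k + 3) (Timed.cmpList c l m) := by
  refine loop_le_pow hX hl ?_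
  clear hl
  induction l generalizing m with
  | nil => cases m <;> simp [Timed.cmpList, Timed.op]
  | cons x l ih =>
    cases m with
    | nil => simp [Timed.cmpList, Timed.op]
    | cons y m =>
      have h1 := ih fun u hu v hv =>
        hc u (List.mem_cons_of_mem _ hu) v (List.mem_cons_of_mem _ hv)
      have h2 : (c x y).time ≤ X ^ k := hc x List.mem_cons_self y List.mem_cons_self
      have h3 : (Timed.cmpList c (x :: l) (y :: m)).time
          ≤ (c x y).time + ((Timed.cmpList c l m).time + 1) := by
        change (c x y).time + (match (c x y).val with
          | .lt => Timed.op .lt | .gt => Timed.op .gt | .eq => Timed.cmpList c l m : Timed _).time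
          ≤ _
        split <;> simp [Timed.op]
      rw [List.length_cons, add_mul]
      omega

theorem insert (hX : 2 ≤ X) {c : α → α → Timed Ordering} {x : α} {l : List α}
    (hl : l.length ≤ X) (hc : ∀ y ∈ l, Within X k (c x y)) :
    Within X (k + 3) (Timed.insert c x l) := by
  refine loop_le_pow hX hl ?_
  clear hl
  induction l with
  | nil => simp [Timed.insert, Timed.op]
  | cons y l ih =>
    have h1 := ih fun u hu => hc u (List.mem_cons_of_mem _ hu)
    have h2 : (c x y).time ≤ X ^ k := hc y List.mem_cons_self
    have h3 : (Timed.insert c x (y :: l)).time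
        ≤ (c x y).time + ((Timed.insert c x l).time + 1) := by
      change (c x y).time + (match (c x y).val with
        | .lt => Timed.op (x :: y :: l) | .eq => Timed.op (y :: l)
        | .gt => (do
          let r ← Timed.insert c x l
          Timed.op (y :: r)) : Timed _).time ≤ _
      split
      · simp [Timed.op]
      · simp [Timed.op]
      · exact le_rfl
    rw [List.length_cons, add_mul]
    omega

end Within

/-! ### Values of the list programs -/

namespace Timed

variable {α β : Type}

@[simp] theorem val_filter (l : List α) (f : α → Timed Bool) :
    (filter l f).val = l.filter fun x => (f x).val := by
  induction l with
  | nil => rfl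
  | cons x l ih => simp [filter, ih, List.filter_cons]

@[simp] theorem val_collect (l : List α) (f : α → Timed β) :
    (collect l f).val = l.map fun x => (f x).val := by
  induction l with
  | nil => rfl
  | cons x l ih => simp [collect, ih]

@[simp] theorem val_append (l m : List α) : (append l m).val = l ++ m := by
  induction l with
  | nil => rfl
  | cons x l ih => simp [append, ih]

theorem val_cmpList (c : α → α → Timed Ordering) (l m : List α) :
    (cmpList c l m).val = List.compareLex (fun x y => (c x y).val) l m := by
  induction l generalizing m with
  | nil => cases m <;> rfl
  | cons x l ih =>
    cases m with
    | nil => rfl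
    | cons y m =>
      rw [List.compareLex_cons_cons, ← ih]
      change (match (c x y).val with
        | .lt => op .lt | .gt => op .gt | .eq => cmpList c l m : Timed Ordering).val = _
      cases (c x y).val <;> rfl

theorem val_insert_cons (c : α → α → Timed Ordering) (x y : α) (l : List α) :
    (insert c x (y :: l)).val = match (c x y).val with
      | .lt => x :: y :: l
      | .eq => y :: l
      | .gt => y :: (insert c x l).val := by
  change (match (c x y).val with
    | .lt => op (x :: y :: l) | .eq => op (y :: l)
    | .gt => (do
      let r ← insert c x l
      op (y :: r)) : Timed (List α)).val = _
  cases (c x y).val <;> rfl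

theorem val_sort_cons (c : α → α → Timed Ordering) (x : α) (l : List α) :
    (sort c (x :: l)).val = (insert c x (sort c l).val).val := rfl

theorem mem_insert {c : α → α → Timed Ordering} {x y : α} {l : List α}
    (h : y ∈ (insert c x l).val) : y = x ∨ y ∈ l := by
  induction l with
  | nil => simpa [insert] using h
  | cons z l ih =>
    rw [val_insert_cons] at h
    split at h
    · simpa using h
    · exact Or.inr h
    · rcases List.mem_cons.1 h with rfl | h
      · simp
      · rcases ih h with h | h
        · exact Or.inl h
        · exact Or.inr (List.mem_cons_of_mem _ h)

theorem length_insert_le (c : α → α → Timed Ordering) (x : α) (l : List α) :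
    (insert c x l).val.length ≤ l.length + 1 := by
  induction l with
  | nil => simp [insert]
  | cons z l ih =>
    rw [val_insert_cons]
    split <;> simp [ih]

theorem mem_of_mem_sort {c : α → α → Timed Ordering} {x : α} {l : List α}
    (h : x ∈ (sort c l).val) : x ∈ l := by
  induction l with
  | nil => exact h
  | cons y l ih =>
    rcases mem_insert h with rfl | h
    · simp
    · exact List.mem_cons_of_mem _ (ih h)

theorem length_sort_le (c : α → α → Timed Ordering) (l : List α) :
    (sort c l).val.length ≤ l.length := by
  induction l with
  | nil => simp [sort]
  | cons x l ih =>
    exact (length_insert_le c x _).trans (Nat.add_le_add_right ih 1)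

section Order

variable {c : α → α → Timed Ordering}

theorem pairwise_insert [Std.TransCmp fun x y => (c x y).val] {x : α} {l : List α}
    (hl : l.Pairwise fun x y => (c x y).val = .lt) :
    (insert c x l).val.Pairwise fun x y => (c x y).val = .lt := by
  induction l with
  | nil => simp [insert]
  | cons y l ih =>
    rw [val_insert_cons]
    have hy := List.pairwise_cons.1 hl
    split
    · rename_i h
      refine List.pairwise_cons.2 ⟨fun z hz => ?_, hl⟩
      rcases List.mem_cons.1 hz with rfl | hz
      · exact h
      · exact Std.TransCmp.lt_trans (cmp := fun x y => (c x y).val) h (hy.1 z hz)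
    · exact hl
    · rename_i h
      refine List.pairwise_cons.2 ⟨fun z hz => ?_, ih hy.2⟩
      rcases mem_insert hz with rfl | hz
      · exact Std.OrientedCmp.lt_of_gt (cmp := fun x y => (c x y).val) h
      · exact hy.1 z hz

theorem pairwise_sort [Std.TransCmp fun x y => (c x y).val] (l : List α) :
    (sort c l).val.Pairwise fun x y => (c x y).val = .lt := by
  induction l with
  | nil => simp [sort]
  | cons x l ih => exact pairwise_insert ih

theorem mem_insert_iff [Std.LawfulEqCmp fun x y => (c x y).val] {x y : α} {l : List α} :
    y ∈ (insert c x l).val ↔ y = x ∨ y ∈ l := by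
  refine ⟨mem_insert, ?_⟩
  induction l with
  | nil => simp [insert]
  | cons z l ih =>
    rw [val_insert_cons]
    split
    · simp
    · rename_i h
      have : x = z := Std.LawfulEqCmp.eq_of_compare (cmp := fun x y => (c x y).val) h
      simp [this]
    · rw [List.mem_cons, List.mem_cons]
      tauto

theorem mem_sort_iff [Std.LawfulEqCmp fun x y => (c x y).val] {x : α} {l : List α} :
    x ∈ (sort c l).val ↔ x ∈ l := by
  induction l with
  | nil => simp [sort]
  | cons y l ih => rw [val_sort_cons, mem_insert_iff, ih, List.mem_cons]

/-- Sorting with removal of duplicates depends only on the set of elements. -/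
theorem sort_congr [Std.TransCmp fun x y => (c x y).val]
    [Std.LawfulEqCmp fun x y => (c x y).val] {l m : List α} (h : ∀ x, x ∈ l ↔ x ∈ m) :
    (sort c l).val = (sort c m).val := by
  have irr : ∀ x, (c x x).val ≠ .lt := fun x hx => by
    have := Std.ReflCmp.compare_self (cmp := fun x y => (c x y).val) (a := x)
    simp_all
  have nd : ∀ l, (sort c l).val.Nodup := fun l =>
    (pairwise_sort (c := c) l).imp fun {x y} hxy => by
      rintro rfl
      exact irr x hxy
  refine List.Perm.eq_of_pairwise ?_ (pairwise_sort l) (pairwise_sort m)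
    ((List.perm_ext_iff_of_nodup (nd l) (nd m)).2 fun x => by rw [mem_sort_iff, mem_sort_iff, h])
  intro x y _ _ hxy hyx
  exact (irr x (Std.TransCmp.lt_trans (cmp := fun x y => (c x y).val) hxy hyx)).elim

end Order

end Timed

theorem Within.sort {α : Type} {X k : ℕ} (hX : 2 ≤ X) {c : α → α → Timed Ordering} {l : List α}
    (hl : l.length ≤ X) (hc : ∀ x ∈ l, ∀ y ∈ l, Within X k (c x y)) :
    Within X (k + 6) (Timed.sort c l) := by
  refine loop_le_pow (k := k + 3) hX hl ?_
  induction l with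
  | nil => simp [Timed.sort, Timed.op]
  | cons x l ih =>
    have hl' : l.length + 1 ≤ X := by simpa using hl
    have h1 := ih (by omega) fun u hu v hv =>
      hc u (List.mem_cons_of_mem _ hu) v (List.mem_cons_of_mem _ hv)
    have h2 : (Timed.insert c x (Timed.sort c l).val).time ≤ X ^ (k + 3) :=
      Within.insert hX ((length_sort_le c l).trans (by omega)) fun y hy =>
        hc x List.mem_cons_self y (List.mem_cons_of_mem _ (mem_of_mem_sort hy))
    have h3 : (Timed.sort c (x :: l)).time
        = (Timed.sort c l).time + (Timed.insert c x (Timed.sort c l).val).time := rfl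
    rw [h3, List.length_cons, add_mul]
    omega

/-! ### The number of worlds of a contraction -/

theorem transCmp_comap {α β : Type} {c : β → β → Ordering} (f : α → β) [Std.TransCmp c] :
    Std.TransCmp fun x y => c (f x) (f y) where
  eq_swap := Std.OrientedCmp.eq_swap (cmp := c)
  isLE_trans := Std.TransCmp.isLE_trans (cmp := c)

theorem val_cmpList_eq {α : Type} (c : α → α → Timed Ordering) :
    (fun l m => (cmpList c l m).val) = List.compareLex fun x y => (c x y).val := by
  funext l m
  exact val_cmpList c l m

theorem Sig.val_cmp_succ (h : ℕ) : (fun x y : Sig (h + 1) => (Sig.cmp (h + 1) x y).val)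
    = compareLex (fun x y : List Bool × List (List (Sig h)) => (cmpList cmpBool x.1 y.1).val)
      (fun x y => (cmpList (cmpList (Sig.cmp h)) x.2 y.2).val) := by
  funext x y
  change (match (cmpList cmpBool x.1 y.1).val with
    | .lt => op .lt | .gt => op .gt
    | .eq => cmpList (cmpList (Sig.cmp h)) x.2 y.2 : Timed Ordering).val
      = Ordering.then (cmpList cmpBool x.1 y.1).val (cmpList (cmpList (Sig.cmp h)) x.2 y.2).val
  cases (cmpList cmpBool x.1 y.1).val <;> rfl

theorem transCmp_cmpBool : Std.TransCmp fun x y => (cmpBool x y).val :=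
  inferInstanceAs (Std.TransCmp (compare : Bool → Bool → Ordering))

theorem lawfulEqCmp_cmpBool : Std.LawfulEqCmp fun x y => (cmpBool x y).val :=
  inferInstanceAs (Std.LawfulEqCmp (compare : Bool → Bool → Ordering))

instance Sig.transCmp (h : ℕ) : Std.TransCmp fun x y => (Sig.cmp h x y).val := by
  have hB := transCmp_cmpBool
  induction h with
  | zero =>
    change Std.TransCmp fun x y => (cmpList cmpBool x y).val
    rw [val_cmpList_eq]
    infer_instance
  | succ h ih =>
    have h1 : Std.TransCmp fun x y => (cmpList cmpBool x y).val := by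
      rw [val_cmpList_eq]
      infer_instance
    have h2 : Std.TransCmp fun x y => (cmpList (cmpList (Sig.cmp h)) x y).val := by
      rw [val_cmpList_eq, val_cmpList_eq]
      infer_instance
    rw [Sig.val_cmp_succ]
    have h3 := transCmp_comap (c := fun x y => (cmpList cmpBool x y).val)
      (Prod.fst : List Bool × List (List (Sig h)) → _)
    have h4 := transCmp_comap (c := fun x y => (cmpList (cmpList (Sig.cmp h)) x y).val)
      (Prod.snd : List Bool × List (List (Sig h)) → _)
    exact inferInstanceAs (Std.TransCmp (compareLex
      (fun x y : List Bool × List (List (Sig h)) => (cmpList cmpBool x.1 y.1).val)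
      (fun x y => (cmpList (cmpList (Sig.cmp h)) x.2 y.2).val)))

instance Sig.lawfulEqCmp (h : ℕ) : Std.LawfulEqCmp fun x y => (Sig.cmp h x y).val := by
  have hB := lawfulEqCmp_cmpBool
  induction h with
  | zero =>
    change Std.LawfulEqCmp fun x y => (cmpList cmpBool x y).val
    rw [val_cmpList_eq]
    infer_instance
  | succ h ih =>
    have h1 : Std.LawfulEqCmp fun x y => (cmpList cmpBool x y).val := by
      rw [val_cmpList_eq]
      infer_instance
    have h2 : Std.LawfulEqCmp fun x y => (cmpList (cmpList (Sig.cmp h)) x y).val := by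
      rw [val_cmpList_eq, val_cmpList_eq]
      infer_instance
    refine @Std.LawfulEqCmp.mk _ _ ⟨fun {x} => ?_⟩ fun {x y} hxy => ?_
    · exact Std.ReflCmp.compare_self (cmp := fun x y => (Sig.cmp (h + 1) x y).val)
    · have hxy' : Ordering.then (cmpList cmpBool x.1 y.1).val
          (cmpList (cmpList (Sig.cmp h)) x.2 y.2).val = .eq :=
        (congrFun (congrFun (Sig.val_cmp_succ h) x) y).symm.trans hxy
      rw [Ordering.then_eq_eq] at hxy'
      exact Prod.ext
        (Std.LawfulEqCmp.eq_of_compare (cmp := fun x y => (cmpList cmpBool x y).val) hxy'.1)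
        (Std.LawfulEqCmp.eq_of_compare
          (cmp := fun x y => (cmpList (cmpList (Sig.cmp h)) x y).val) hxy'.2)

variable {a p : ℕ}

/-- The number of `h`-signatures over `a` agents and `p` atoms. -/
def sigCard (a p : ℕ) : ℕ → ℕ
  | 0 => 2 ^ p
  | h + 1 => 2 ^ p * (2 ^ sigCard a p h) ^ a

theorem val_sig_succ (s : State a p) (h : ℕ) (w : Fin s.n) :
    (sig s (h + 1)).val w = ((List.finRange p).map (s.lab w), (List.finRange a).map fun i =>
      (sort (Sig.cmp h) (((List.finRange s.n).filter (s.rel i w)).map (sig s h).val)).val) := by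
  have : (sig s (h + 1)).val w = ((collect (List.finRange p) fun q => op (s.lab w q)).val,
    (collect (List.finRange a) fun i => do
        let vs ← filter (List.finRange s.n) fun v => op (s.rel i w v)
        let xs ← collect vs fun v => op ((sig s h).val v)
        sort (Sig.cmp h) xs).val) := rfl
  rw [this]
  simp only [val_collect, val_bind, val_filter, val_op]
  rfl

/-- The worlds of a single state can be classified by `sigCard a p h` codes that determine the
`h`-signature: at level `h + 1` the code is the label together with the set of codes of the
successors for each agent, and a sorted list depends only on the set of its elements. -/
theorem exists_code (s : State a p) (h : ℕ) : ∃ c : Fin s.n → Fin (sigCard a p h),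
    ∀ x y, c x = c y → (sig s h).val x = (sig s h).val y := by
  induction h with
  | zero =>
    let e : (Fin p → Bool) ≃ Fin (sigCard a p 0) :=
      Fintype.equivFinOfCardEq (by simp [sigCard])
    refine ⟨fun x => e (s.lab x), fun x y hxy => ?_⟩
    have hl : s.lab x = s.lab y := e.injective hxy
    change (collect (List.finRange p) fun q => op (s.lab x q)).val
      = (collect (List.finRange p) fun q => op (s.lab y q)).val
    rw [hl]
  | succ h ih =>
    obtain ⟨c, hc⟩ := ih
    let e : (Fin p → Bool) × (Fin a → Finset (Fin (sigCard a p h)))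
        ≃ Fin (sigCard a p (h + 1)) := Fintype.equivFinOfCardEq (by simp [sigCard])
    refine ⟨fun x => e (s.lab x, fun i => (Finset.univ.filter fun v => s.rel i x v).image c),
      fun x y hxy => ?_⟩
    have hp := e.injective hxy
    rw [Prod.mk.injEq] at hp
    obtain ⟨hl, hr⟩ := hp
    have key : ∀ x y : Fin s.n, ∀ i : Fin a,
        (Finset.univ.filter fun v => s.rel i x v).image c
          = (Finset.univ.filter fun v => s.rel i y v).image c →
        ∀ z, z ∈ ((List.finRange s.n).filter (s.rel i x)).map (sig s h).val →
          z ∈ ((List.finRange s.n).filter (s.rel i y)).map (sig s h).val := by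
      intro x y i hi z hz
      simp only [List.mem_map, List.mem_filter, List.mem_finRange, true_and] at hz ⊢
      obtain ⟨v, hv, rfl⟩ := hz
      have hm : c v ∈ (Finset.univ.filter fun v => s.rel i x v).image c :=
        Finset.mem_image_of_mem c (by simpa using hv)
      rw [hi] at hm
      obtain ⟨v', hv', hcv⟩ := Finset.mem_image.1 hm
      exact ⟨v', by simpa using hv', hc _ _ hcv⟩
    rw [val_sig_succ, val_sig_succ, hl]
    refine Prod.ext rfl (List.map_congr_left fun i _ => sort_congr fun z => ?_)
    exact ⟨key x y i (congrFun hr i) z, key y x i (congrFun hr i).symm z⟩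

theorem length_sort_sig_le (s : State a p) (h : ℕ) (xs : List (Fin s.n)) :
    (sort (fun x y => Sig.cmp h ((sig s h).val x) ((sig s h).val y)) xs).val.length
      ≤ sigCard a p h := by
  obtain ⟨c, hc⟩ := exists_code s h
  have ht : Std.TransCmp fun x y : Fin s.n =>
      (Sig.cmp h ((sig s h).val x) ((sig s h).val y)).val :=
    transCmp_comap (c := fun x y => (Sig.cmp h x y).val) (sig s h).val
  have hn : ((sort (fun x y => Sig.cmp h ((sig s h).val x) ((sig s h).val y)) xs).val.map
      c).Nodup := by
    refine List.pairwise_map.2 ((pairwise_sort (c := fun x y : Fin s.n =>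
      Sig.cmp h ((sig s h).val x) ((sig s h).val y)) xs).imp ?_)
    intro x y hxy hcxy
    rw [hc x y hcxy, Std.ReflCmp.compare_self (cmp := fun x y => (Sig.cmp h x y).val)] at hxy
    exact Ordering.noConfusion hxy
  simpa using hn.length_le_card

theorem length_repsBelow_le {b : ℕ} (s : State a p) (d : Fin s.n → Option (Fin (b + 1)))
    (maximal : Fin s.n → Bool) (k : ℕ) :
    (repsBelow s d maximal k).val.length ≤ ∑ h ∈ Finset.range k, sigCard a p h := by
  induction k with
  | zero => simp [repsBelow]
  | succ k ih =>
    have : (repsBelow s d maximal (k + 1)).val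
        = (sort (fun x y => Sig.cmp k ((sig s k).val x) ((sig s k).val y))
            (filter (List.finRange s.n) fun x =>
              op (maximal x && (d x).map Fin.val == some k)).val).val
          ++ (repsBelow s d maximal k).val := by
      rw [← val_append]
      rfl
    rw [this, List.length_append, Finset.sum_range_succ, add_comm]
    exact Nat.add_le_add ih (length_sort_sig_le s k _)

/-- A bound on the number of worlds of a `b`-contraction that does not depend on the state: all
worlds but the designated one are signatures of depth less than `b`. -/
def worldBound (a p b : ℕ) : ℕ := ∑ h ∈ Finset.range b, sigCard a p h + 1

theorem n_contract_le (s : State a p) (b : ℕ) : (contract s b).val.n ≤ worldBound a p b :=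
  Nat.add_le_add_right (length_repsBelow_le s _ _ b) 1

theorem worldBound_mono {b c : ℕ} (h : b ≤ c) : worldBound a p b ≤ worldBound a p c :=
  Nat.add_le_add_right (Finset.sum_le_sum_of_subset (Finset.range_subset_range.2 h)) 1

/-! ### Running times of the subroutines -/

/-- The number of events of an action and the lengths of its conditions are at most `M`. -/
structure Action.Fits {a p : ℕ} (M : ℕ) (α : Action a p) : Prop where
  events : α.m ≤ M
  pre : ∀ e, (α.pre e).size ≤ M
  post : ∀ e q, (α.post e q).size ≤ M

section Subroutines

variable {a p X : ℕ}

theorem Fml.time_depth_le (φ : Fml a p) : φ.depth.time ≤ φ.size := by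
  induction φ with
  | top => exact le_rfl
  | atom q => exact le_rfl
  | neg φ ih => exact Nat.add_le_add_right ih 1
  | and φ ψ ih ih' =>
    change φ.depth.time + (ψ.depth.time + 1) ≤ φ.size + ψ.size + 1
    omega
  | box i φ ih => exact Nat.add_le_add_right ih 1

theorem Fml.within_depth {φ : Fml a p} (hφ : φ.size ≤ X) : Within X 1 φ.depth :=
  φ.time_depth_le.trans (by simpa using hφ)

theorem Action.within_depth (hX : 2 ≤ X) (hp : p ≤ X) {α : Action a p} (hα : α.Fits X) :
    Within X 9 α.depth := by
  unfold Action.depth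
  refine (Within.maxOf hX (k := 6) (by simpa using hα.events) fun e _ => ?_)
  exact Within.mono hX (Within.bind hX (Fml.within_depth (hα.pre e)) (Within.bind hX
    (Within.maxOf hX (by simpa using hp) fun q _ => Fml.within_depth (hα.post e q))
    (Within.op (k := 0) hX _))) (by omega)

theorem Fml.within_check (hX : 2 ≤ X) {s : State a p} (hs : s.n ≤ X) {φ : Fml a p}
    (hφ : φ.size ≤ X) : Within X 7 (φ.check s) := by
  have h3 : X ^ 3 ≤ X ^ 6 := Nat.pow_le_pow_right (by omega) (by omega)
  have key : (φ.check s).time ≤ φ.size * X ^ 6 := by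
    clear hφ
    induction φ with
    | top =>
      have : Within X 3 (Fml.top.check s) := Within.tab hX hs fun w => Within.op hX _
      simp only [Within] at this
      simp only [Fml.size]
      omega
    | atom q =>
      have : Within X 3 ((Fml.atom q).check s) := Within.tab hX hs fun w => Within.op hX _
      simp only [Within] at this
      simp only [Fml.size]
      omega
    | neg φ ih =>
      have h1 : Within X 3 (tab s.n fun w => op (!(φ.check s).val w)) :=
        Within.tab hX hs fun w => Within.op hX _
      have h2 := Nat.add_le_add ih (h1.trans h3)
      simp only [Fml.size, add_mul, one_mul]
      exact h2
    | and φ ψ ih ih' =>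
      have h1 : Within X 3 (tab s.n fun w => op ((φ.check s).val w && (ψ.check s).val w)) :=
        Within.tab hX hs fun w => Within.op hX _
      have h2 := Nat.add_le_add ih (Nat.add_le_add ih' (h1.trans h3))
      simp only [Fml.size, add_mul, one_mul, add_assoc]
      exact h2
    | box i φ ih =>
      have h1 : Within X 6 (tab s.n fun w => all (List.finRange s.n) fun v =>
          op (!s.rel i w v || (φ.check s).val v)) :=
        Within.tab hX hs fun w => Within.all hX (by simpa using hs) fun v _ => Within.op hX _
      have h2 := Nat.add_le_add ih h1
      simp only [Fml.size, add_mul, one_mul]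
      exact h2
  refine key.trans ?_
  rw [pow_succ, mul_comm]
  exact Nat.mul_le_mul_left _ hφ

theorem within_applicable (hX : 2 ≤ X) {s : State a p} (hs : s.n ≤ X) {α : Action a p}
    (hα : α.Fits X) : Within X 8 (applicable s α) :=
  Within.mono hX (Within.bind hX (Fml.within_check hX hs (hα.pre α.pt))
    (Within.op (k := 0) hX _)) (by omega)

/-- The summand `1` accounts for the designated pair, which is listed separately. -/
theorem n_update_le (s : State a p) (α : Action a p) : (update s α).val.n ≤ s.n * α.m + 1 := by
  unfold update
  simp only [val_bind, val_op, val_filter]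
  refine Nat.add_le_add_right ((List.length_filter_le _ _).trans ?_) 1
  exact (List.length_product _ _).trans_le (by simp)

theorem within_update (hX : 2 ≤ X) (ha : a ≤ X) (hp : p ≤ X) {s : State a p} {α : Action a p}
    (hα : α.Fits X) (hs : s.n ≤ X) (hsα : s.n * α.m + 1 ≤ X) : Within X 20 (update s α) := by
  have hr := (n_update_le s α).trans hsα
  unfold update at hr ⊢
  -- `by exact` delays the check until unification has found the length of the array.
  refine Within.mono hX (Within.bind hX (Within.tab hX hα.events fun e =>
      Fml.within_check hX hs (hα.pre e))
    (Within.bind hX (Within.tab hX hα.events fun e => Within.tab hX hp fun q =>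
      Fml.within_check hX hs (hα.post e q))
    (Within.bind hX (Within.filter hX ?_ fun x _ => Within.op (k := 0) hX _)
    (Within.bind hX (Within.toArr hX (by exact hr))
    (Within.bind hX (Within.tab hX ha fun i => Within.tab hX (by exact hr) fun j =>
      Within.tab hX (by exact hr) fun k =>
      Within.op (k := 0) hX _)
    (Within.bind hX (Within.tab hX (by exact hr) fun j => Within.tab hX hp fun q =>
      Within.op (k := 0) hX _)
    (Within.op (k := 0) hX _))))))) (by omega)
  exact (List.length_product _ _).trans_le (by simpa using Nat.le_of_succ_le hsα)

/-- The number of rounds may be as large as the number of pairs of worlds, so the exponent must not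
grow with `h`: each round costs at most `X ^ 20`, and the costs of the rounds are added up. -/
theorem within_refine (hX : 2 ≤ X) (ha : a ≤ X) (hp : p ≤ X) {s t : State a p} (hs : s.n ≤ X)
    (ht : t.n ≤ X) {h : ℕ} (hh : h ≤ X * X) : Within X 23 (refine s t h) := by
  have key : (refine s t h).time ≤ (h + 1) * X ^ 20 := by
    clear hh
    induction h with
    | zero =>
      have : Within X 20 (refine s t 0) :=
        Within.mono hX (Within.tab hX hs fun u => Within.tab hX ht fun v =>
          Within.all hX (by simpa using hp) fun q _ => Within.op (k := 0) hX _) (by omega)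
      simpa [Within] using this
    | succ h ih =>
      have hs' : (List.finRange s.n).length ≤ X := by simpa using hs
      have ht' : (List.finRange t.n).length ≤ X := by simpa using ht
      have ha' : (List.finRange a).length ≤ X := by simpa using ha
      have h1 : Within X 20 (tab s.n fun u => tab t.n fun v => do
          let forth ← all (List.finRange a) fun i => all (List.finRange s.n) fun u' => do
            let r ← any (List.finRange t.n) fun v' =>
              op (t.rel i v v' && (refine s t h).val u' v')
            op (!s.rel i u u' || r)
          let back ← all (List.finRange a) fun i => all (List.finRange t.n) fun v' => do
            let r ← any (List.finRange s.n) fun u' =>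
              op (s.rel i u u' && (refine s t h).val u' v')
            op (!t.rel i v v' || r)
          op ((refine s t h).val u v && forth && back)) :=
        Within.mono hX (Within.tab hX hs fun u => Within.tab hX ht fun v =>
        Within.bind hX (Within.all hX ha' fun i _ => Within.all hX hs' fun u' _ =>
          Within.bind hX (Within.any hX ht' fun v' _ => Within.op (k := 0) hX _)
            (Within.op (k := 0) hX _))
        (Within.bind hX (Within.all hX ha' fun i _ => Within.all hX ht' fun v' _ =>
          Within.bind hX (Within.any hX hs' fun u' _ => Within.op (k := 0) hX _)
            (Within.op (k := 0) hX _))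
        (Within.op (k := 0) hX _))) (by omega)
      rw [add_mul, one_mul]
      exact Nat.add_le_add ih h1
  refine key.trans ?_
  have h3 : h + 1 ≤ X ^ 3 := by
    have : X * X * 2 ≤ X * X * X := Nat.mul_le_mul_left _ hX
    have : 2 * 2 ≤ X * X := Nat.mul_le_mul hX hX
    rw [show X ^ 3 = X * X * X by ring]
    omega
  rw [show X ^ 23 = X ^ 3 * X ^ 20 by ring]
  exact Nat.mul_le_mul_right _ h3

theorem within_bisimTest (hX : 2 ≤ X) (ha : a ≤ X) (hp : p ≤ X) {s t : State a p} (hs : s.n ≤ X)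
    (ht : t.n ≤ X) : Within X 24 (bisimTest s t) :=
  Within.mono hX (Within.bind hX (within_refine hX ha hp hs ht (Nat.mul_le_mul hs ht))
    (Within.op (k := 0) hX _)) (by omega)

/-- Comparing two signatures of worlds of the same state takes polynomial time for fixed `h`:
at each level they consist of at most `a` lists of at most `s.n` signatures. -/
theorem within_cmp_sig (hX : 2 ≤ X) (ha : a ≤ X) (hp : p ≤ X) {s : State a p} (hs : s.n ≤ X)
    (h : ℕ) (u v : Fin s.n) :
    Within X (7 * h + 3) (Sig.cmp h ((sig s h).val u) ((sig s h).val v)) := by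
  induction h generalizing u v with
  | zero =>
    change Within X (0 + 3) (cmpList cmpBool _ _)
    refine Within.cmpList hX ?_ fun x _ y _ => Within.op hX _
    change (collect (List.finRange p) fun q => op (s.lab u q)).val.length ≤ X
    simpa using hp
  | succ h ih =>
    rw [val_sig_succ, val_sig_succ]
    unfold Sig.cmp
    have key : ∀ x y : List Bool × List (List (Sig h)), x.1.length ≤ X →
        Within X (7 * h + 9) (cmpList (cmpList (Sig.cmp h)) x.2 y.2) →
        Within X (7 * (h + 1) + 3) (do
          match ← cmpList cmpBool x.1 y.1 with
          | .lt => op .lt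
          | .gt => op .gt
          | .eq => cmpList (cmpList (Sig.cmp h)) x.2 y.2 : Timed Ordering) := by
      intro x y hx hxy
      refine Within.mono hX (Within.bind (l := 7 * h + 9) hX (Within.cmpList (k := 0) hX hx
        fun x _ y _ => Within.op hX _) ?_) (by omega)
      split
      · exact Within.op hX _
      · exact Within.op hX _
      · exact hxy
    refine key _ _ (by simpa using hp) ?_
    refine Within.cmpList (k := 7 * h + 6) hX (by simpa using ha) fun l hl m hm => ?_
    simp only [List.mem_map] at hl hm
    obtain ⟨i, -, rfl⟩ := hl
    obtain ⟨j, -, rfl⟩ := hm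
    refine Within.cmpList (k := 7 * h + 3) hX ?_ fun x hx y hy => ?_
    · refine (length_sort_le _ _).trans ?_
      rw [List.length_map]
      exact (List.length_filter_le _ _).trans (by simpa using hs)
    · obtain ⟨x', -, rfl⟩ := List.mem_map.1 (mem_of_mem_sort hx)
      obtain ⟨y', -, rfl⟩ := List.mem_map.1 (mem_of_mem_sort hy)
      exact ih x' y'

theorem within_sig (hX : 2 ≤ X) (ha : a ≤ X) (hp : p ≤ X) {s : State a p} (hs : s.n ≤ X)
    (h : ℕ) : Within X (7 * h + 20) (sig s h) := by
  have hp' : (List.finRange p).length ≤ X := by simpa using hp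
  have hs' : (List.finRange s.n).length ≤ X := by simpa using hs
  induction h with
  | zero =>
    exact Within.mono (k := 0 + 3 + 3) hX (Within.tab hX hs fun w =>
      Within.collect hX hp' fun q _ => Within.op hX _) (by omega)
  | succ h ih =>
    unfold sig
    refine Within.mono hX (Within.bind hX ih (Within.tab (k := 7 * h + 17) hX hs fun w => ?_))
      (by omega)
    refine Within.mono hX (Within.bind hX (Within.collect (k := 0) hX hp' fun q _ => Within.op hX _)
      (Within.bind hX (Within.collect (k := 7 * h + 12) hX (by simpa using ha) fun i _ => ?_)
        (Within.op (k := 0) hX _))) (by omega)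
    have hf : (filter (List.finRange s.n) fun v => op (s.rel i w v)).val.length ≤ X := by
      rw [val_filter]
      exact (List.length_filter_le _ _).trans hs'
    refine Within.mono hX (Within.bind hX (Within.filter (k := 0) hX hs' fun v _ => Within.op hX _)
      (Within.bind hX (Within.collect (k := 0) hX hf fun v _ => Within.op hX _)
        (Within.sort (k := 7 * h + 3) hX (by simpa using hf) fun x hx y hy => ?_))) (by omega)
    rw [val_collect, List.mem_map] at hx hy
    obtain ⟨x', -, rfl⟩ := hx
    obtain ⟨y', -, rfl⟩ := hy
    exact within_cmp_sig hX ha hp hs h x' y'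

theorem within_boundsUpTo (hX : 2 ≤ X) (ha : a ≤ X) {s : State a p} (hs : s.n ≤ X) (b r : ℕ) :
    Within X (r + 20) (boundsUpTo s b r) := by
  induction r with
  | zero =>
    exact Within.mono (k := 0 + 3) hX (Within.tab hX hs fun w => Within.op hX _) (by omega)
  | succ r ih =>
    unfold boundsUpTo
    exact Within.mono hX (Within.bind hX ih (Within.tab hX hs fun w => Within.bind hX
      (Within.any hX (by simpa using ha) fun i _ => Within.any hX (by simpa using hs) fun v _ =>
        Within.op (k := 0) hX _) (Within.op (k := 0) hX _))) (by omega)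

theorem within_repsBelow (hX : 2 ≤ X) (ha : a ≤ X) (hp : p ≤ X) {s : State a p} (hs : s.n ≤ X)
    {b : ℕ} (d : Fin s.n → Option (Fin (b + 1))) (maximal : Fin s.n → Bool) (k : ℕ) :
    Within X (7 * k + 30) (repsBelow s d maximal k) := by
  have hs' : (List.finRange s.n).length ≤ X := by simpa using hs
  induction k with
  | zero => exact Within.op hX _
  | succ k ih =>
    have hf : (filter (List.finRange s.n) fun x =>
        op (maximal x && (d x).map Fin.val == some k)).val.length ≤ X := by
      rw [val_filter]
      exact (List.length_filter_le _ _).trans hs'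
    unfold repsBelow
    exact Within.mono hX (Within.bind hX (within_sig hX ha hp hs k)
      (Within.bind hX (Within.filter hX hs' fun x _ => Within.op (k := 0) hX _)
      (Within.bind hX (Within.sort hX hf fun x _ y _ => within_cmp_sig hX ha hp hs k x y)
      (Within.bind hX ih
      (Within.append hX ((length_sort_le _ _).trans hf)))))) (by omega)

theorem within_contract (hX : 2 ≤ X) (ha : a ≤ X) (hp : p ≤ X) {s : State a p} (hs : s.n ≤ X)
    {b : ℕ} (hb : b + 1 ≤ X) (hW : worldBound a p b ≤ X) :
    Within X (7 * b + 50) (contract s b) := by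
  have hs' : (List.finRange s.n).length ≤ X := by simpa using hs
  have hr := (n_contract_le s b).trans hW
  unfold contract at hr ⊢
  refine Within.mono hX (Within.bind hX (within_boundsUpTo hX ha hs b b)
    (Within.bind hX (Within.tab hX hb fun h => within_refine hX ha hp hs hs
      (h := h) ((show (h : ℕ) ≤ X by omega).trans (Nat.le_mul_self X)))
    (Within.bind hX (Within.tab hX hs fun x => Within.bind hX
      (Within.any hX hs' fun y _ => Within.op (k := 0) hX _) (Within.op (k := 0) hX _))
    (Within.bind hX (within_repsBelow hX ha hp hs _ _ b)
    (Within.bind hX (Within.toArr hX (by exact hr))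
    (Within.bind hX (Within.tab hX ha fun i => Within.tab hX (by exact hr) fun j =>
      Within.tab hX (by exact hr) fun j' =>
      Within.any hX hs' fun z _ => Within.bind hX
        (Within.find hX (by simpa using hr) fun y _ => Within.op (k := 0) hX _)
        (Within.op (k := 0) hX _))
    (Within.bind hX (Within.tab hX (by exact hr) fun j => Within.tab hX hp fun q =>
      Within.op (k := 0) hX _)
    (Within.op (k := 0) hX _)))))))) (by omega)

theorem within_sameState (hX : 2 ≤ X) (ha : a ≤ X) (hp : p ≤ X) {s t : State a p} (hs : s.n ≤ X) :
    Within X 15 (sameState s t) := by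
  have hs' : (List.finRange s.n).length ≤ X := by simpa using hs
  unfold sameState
  split
  · exact Within.mono hX (Within.bind hX (Within.all hX (by simpa using ha) fun i _ =>
      Within.all hX hs' fun u _ =>
      Within.all hX hs' fun v _ => Within.op (k := 0) hX _)
      (Within.bind hX (Within.all hX hs' fun u _ => Within.all hX (by simpa using hp) fun q _ =>
        Within.op (k := 0) hX _) (Within.op (k := 0) hX _))) (by omega)
  · exact Within.op hX _

theorem sameState_self (s : State a p) : (sameState s s).val = true := by
  simp [sameState]

theorem DuplicateRule.within_covers (hX : 2 ≤ X) (ha : a ≤ X) (hp : p ≤ X) (ρ : DuplicateRule)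
    {N : Node a p} (N' : Node a p) (hN : N.state.n ≤ X) : Within X 16 (ρ.covers N N') := by
  unfold DuplicateRule.covers
  exact Within.mono hX (Within.bind hX (Within.op (k := 0) hX _)
    (Within.ite hX (within_sameState hX ha hp hN)
    (Within.op (k := 0) hX _))) (by omega)

/-- Each of the duplicate rules rejects at least the exact repetitions. -/
theorem DuplicateRule.covers_of_eq (ρ : DuplicateRule) {N N' : Node a p}
    (hs : N.state = N'.state) (hb : N.bound = N'.bound) (hf : N.isBisim = N'.isBisim) :
    (ρ.covers N N').val = true := by
  cases ρ <;> simp [DuplicateRule.covers, hs, hb, hf, sameState_self]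

theorem within_initNode (hX : 2 ≤ X) (ha : a ≤ X) (hp : p ≤ X) {s : State a p} (hs : s.n ≤ X)
    {b : ℕ} (hb : b + 1 ≤ X) (hW : worldBound a p b ≤ X) (f : Bool) (π : List (Action a p)) :
    Within X (7 * b + 53) (initNode s b f π) := by
  unfold initNode
  exact Within.mono hX (Within.bind hX (within_contract hX ha hp hs hb hW)
    (Within.ite hX
      (Within.bind hX (within_bisimTest hX ha hp ((n_contract_le s b).trans hW) hs)
        (Within.op (k := 0) hX _))
      (Within.bind hX (Within.op (k := 0) hX _) (Within.op (k := 0) hX _)))) (by omega)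

end Subroutines

/-! ### Running time of the search -/

/-- `X` dominates all quantities that occur in a search with bound `b`, for actions whose numbers
of events and lengths of conditions are at most `M`. -/
structure Dominates (X a p b M : ℕ) : Prop where
  two_le : 2 ≤ X
  agents : a ≤ X
  atoms : p ≤ X
  bound : b + 1 ≤ X
  one_le : 1 ≤ M
  action : M ≤ X
  product : worldBound a p b * M + 1 ≤ X

section Search

variable {a p b M X : ℕ}

theorem Dominates.worlds (h : Dominates X a p b M) : worldBound a p b ≤ X :=
  (Nat.le_mul_of_pos_right _ h.one_le).trans ((Nat.le_succ _).trans h.product)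

theorem Action.Fits.mono {M M' : ℕ} {α : Action a p} (h : α.Fits M) (hM : M ≤ M') : α.Fits M' :=
  ⟨h.events.trans hM, fun e => (h.pre e).trans hM, fun e q => (h.post e q).trans hM⟩

/-- The size constraints met by all nodes of a search with bound `b`. -/
structure Node.Bounded (b : ℕ) (N : Node a p) : Prop where
  worlds : N.state.n ≤ worldBound a p b
  bound : N.bound ≤ b

theorem initNode_bounded (s : State a p) {k : ℕ} (hk : k ≤ b) (f : Bool) (π : List (Action a p)) :
    (initNode s k f π).val.Bounded b := by
  unfold initNode
  simp only [val_bind]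
  split <;> exact ⟨(n_contract_le s k).trans (worldBound_mono hk), hk⟩

theorem plan_initNode (s : State a p) (k : ℕ) (f : Bool) (π : List (Action a p)) :
    (initNode s k f π).val.plan = π := by
  unfold initNode
  simp only [val_bind]
  split <;> rfl

theorem childNode_eq_some {N N' : Node a p} (hN : N.Bounded b) {α : Action a p} {dg : ℕ}
    (h : (childNode N α dg).val = some N') : N'.Bounded b ∧ N'.plan = α :: N.plan := by
  unfold childNode at h
  simp only [val_bind] at h
  split at h
  · obtain rfl := Option.some.inj h
    exact ⟨initNode_bounded _ hN.bound _ _, plan_initNode _ _ _ _⟩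
  · split at h
    · obtain rfl := Option.some.inj h
      exact ⟨initNode_bounded _ ((Nat.sub_le _ _).trans hN.bound) _ _, plan_initNode _ _ _ _⟩
    · exact absurd h (by simp)

theorem within_childNode (hX : Dominates X a p b M) {N : Node a p} (hN : N.Bounded b)
    {α : Action a p} (hα : α.Fits M) (dg : ℕ) : Within X (7 * b + 60) (childNode N α dg) := by
  have h2 := hX.two_le
  have hα' := hα.mono hX.action
  have hn : N.state.n ≤ X := hN.worlds.trans hX.worlds
  have hm : N.state.n * α.m + 1 ≤ X :=
    (Nat.succ_le_succ (Nat.mul_le_mul hN.worlds hα.events)).trans hX.product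
  have hu : (update N.state α).val.n ≤ X := (n_update_le _ _).trans hm
  have hi : ∀ k ≤ b, ∀ f π, Within X (7 * b + 53) (initNode (update N.state α).val k f π) :=
    fun k hk f π => (within_initNode h2 hX.agents hX.atoms hu (by have := hX.bound; omega)
      ((worldBound_mono hk).trans hX.worlds) f π).mono h2 (by omega)
  unfold childNode
  exact Within.mono h2 (Within.bind h2 (Action.within_depth h2 hX.atoms hα')
    (Within.ite h2
      (Within.bind h2 (within_update h2 hX.agents hX.atoms hα' hn hm)
        (Within.bind h2 (hi _ hN.bound _ _) (Within.op (k := 0) h2 _)))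
      (Within.ite h2
        (Within.bind h2 (within_update h2 hX.agents hX.atoms hα' hn hm)
          (Within.bind h2 (hi _ ((Nat.sub_le _ _).trans hN.bound) _ _) (Within.op (k := 0) h2 _)))
        (Within.op (k := 0) h2 _)))) (by omega)

/-- The part of a node on which the duplicate test depends. -/
def Node.key (N : Node a p) : State a p × ℕ × Bool := (N.state, N.bound, N.isBisim)

/-- The invariant of the main loop. -/
structure Config.Valid (b : ℕ) (c : Config a p) : Prop where
  frontier : ∀ N ∈ c.frontier, N.Bounded b
  generated : ∀ N ∈ c.generated, N.Bounded b
  nodup : (c.generated.map Node.key).Nodup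
  plan : ∀ N ∈ c.frontier, N.plan.length < c.generated.length
  length : c.frontier.length ≤ c.generated.length

/-- A bound on the number of nodes that can be generated: the triples of a state with at most
`worldBound a p b` worlds, a bound and a flag. -/
def nodeBound (a p b : ℕ) : ℕ :=
  (worldBound a p b + 1) * ((2 ^ (worldBound a p b * worldBound a p b)) ^ a *
    ((2 ^ p) ^ worldBound a p b * worldBound a p b)) * ((b + 1) * 2)

theorem Config.Valid.length_generated_le {c : Config a p} (hc : c.Valid b) :
    c.generated.length ≤ nodeBound a p b := by
  classical
  let Key : Type := (Σ n : Fin (worldBound a p b + 1),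
    (Fin a → Fin n → Fin n → Bool) × (Fin n → Fin p → Bool) × Fin n) × Fin (b + 1) × Bool
  let g : Key → State a p × ℕ × Bool := fun k =>
    (⟨k.1.1, k.1.2.1, k.1.2.2.1, k.1.2.2.2⟩, k.2.1, k.2.2)
  have hsub : (c.generated.map Node.key).toFinset ⊆ Finset.univ.image g := by
    intro x hx
    rw [List.mem_toFinset, List.mem_map] at hx
    obtain ⟨N, hN, rfl⟩ := hx
    have hB := hc.generated N hN
    exact Finset.mem_image.2 ⟨(⟨⟨N.state.n, Nat.lt_succ_of_le hB.worlds⟩,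
      (N.state.rel, N.state.lab, N.state.pt)⟩, ⟨N.bound, Nat.lt_succ_of_le hB.bound⟩, N.isBisim),
      Finset.mem_univ _, rfl⟩
  have h1 : c.generated.length ≤ Fintype.card Key := by
    rw [← List.length_map (f := Node.key), ← List.toFinset_card_of_nodup hc.nodup]
    exact (Finset.card_le_card hsub).trans Finset.card_image_le
  refine h1.trans ?_
  simp only [Key, Fintype.card_prod, Fintype.card_sigma, Fintype.card_fun, Fintype.card_fin,
    Fintype.card_bool]
  refine Nat.mul_le_mul_right _ ?_
  refine (Finset.sum_le_card_nsmul _ _ ((2 ^ (worldBound a p b * worldBound a p b)) ^ a *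
    ((2 ^ p) ^ worldBound a p b * worldBound a p b)) fun n _ => ?_).trans (by simp)
  have hn : (n : ℕ) ≤ worldBound a p b := Nat.lt_succ_iff.1 n.2
  rw [← pow_mul 2 (n : ℕ) n]
  gcongr
  · exact one_le_two
  · exact Nat.one_le_two_pow

/-- The effect and the cost of trying one action: the child node, if there is one that is not
superfluous, is appended to the queue. -/
theorem expand_cons (hX : Dominates X a p b M) (hK : nodeBound a p b ≤ X) (ρ : DuplicateRule)
    (dg : ℕ) {N : Node a p} (hN : N.Bounded b) {α : Action a p} (hα : α.Fits M)
    (l : List (Action a p)) {c : Config a p} (hc : c.Valid b) :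
    ∃ c₁ : Config a p, (expand ρ dg N (α :: l) c).val = (expand ρ dg N l c₁).val ∧
      (expand ρ dg N (α :: l) c).time ≤ X ^ (7 * b + 63) + (expand ρ dg N l c₁).time ∧
      (c₁ = c ∨ ∃ N', N'.Bounded b ∧ N'.plan = α :: N.plan ∧
        (∀ L ∈ c.generated, (ρ.covers L N').val = false) ∧
        c₁ = ⟨c.frontier ++ [N'], N' :: c.generated⟩) := by
  have h2 := hX.two_le
  have hg := hc.length_generated_le.trans hK
  have hpow : ∀ {β : Type} {k : ℕ} {t : Timed β}, Within X k t → k ≤ 7 * b + 60 →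
      t.time ≤ X ^ (7 * b + 60) := fun ht hk => ht.mono h2 hk
  have t1 := hpow (Action.within_depth h2 hX.atoms (hα.mono hX.action)) (by omega)
  have t2 := hpow (within_applicable h2 (hN.worlds.trans hX.worlds) (hα.mono hX.action)) (by omega)
  have t3 := hpow (within_childNode hX hN hα dg) le_rfl
  have t4 : ∀ N', (any c.generated fun L => ρ.covers L N').time ≤ X ^ (7 * b + 60) := fun N' =>
    hpow (Within.any h2 hg fun L hL => ρ.within_covers h2 hX.agents hX.atoms N'
      ((hc.generated L hL).worlds.trans hX.worlds)) (by omega)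
  have t5 : ∀ N', (append c.frontier [N']).time ≤ X ^ (7 * b + 60) := fun N' =>
    hpow (Within.append h2 (hc.length.trans hg)) (by omega)
  have t6 : 1 ≤ X ^ (7 * b + 60) := Nat.one_le_pow _ _ (by omega)
  have hbig : 8 * X ^ (7 * b + 60) ≤ X ^ (7 * b + 63) := by
    rw [show 7 * b + 63 = 3 + (7 * b + 60) by omega, pow_add X 3]
    exact Nat.mul_le_mul_right _ (Nat.pow_le_pow_left h2 3)
  have time_bind : ∀ {β γ : Type} (x : Timed β) (f : β → Timed γ),
    (x >>= f).time = x.time + (f x.val).time := fun _ _ => rfl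
  have time_op : ∀ {β : Type} (x : β), (op x).time = 1 := fun _ => rfl
  rw [expand]
  by_cases h1 : α.depth.val ≤ N.bound
  · cases h3 : (applicable N.state α).val with
    | false =>
      refine ⟨c, ?_, ?_, Or.inl rfl⟩
      · simp [h1, h3]
      · simp only [time_bind, h1, h3, if_true, if_false, Bool.false_eq_true]
        omega
    | true =>
      cases h4 : (childNode N α dg).val with
      | none =>
        refine ⟨c, ?_, ?_, Or.inl rfl⟩
        · simp [h1, h3, h4]
        · simp only [time_bind, h1, h3, h4, if_true]
          omega
      | some N' =>
        have t4 := t4 N'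
        have t5 := t5 N'
        cases h5 : (any c.generated fun L => ρ.covers L N').val with
        | true =>
          refine ⟨c, ?_, ?_, Or.inl rfl⟩
          · simp only [val_bind, h1, h3, h4, h5, if_true]
          · simp only [time_bind, h1, h3, h4, h5, if_true]
            omega
        | false =>
          refine ⟨⟨c.frontier ++ [N'], N' :: c.generated⟩, ?_, ?_, Or.inr ⟨N', ?_, ?_, ?_, rfl⟩⟩
          · simp only [val_bind, val_op, val_append, h1, h3, h4, h5, if_true, if_false,
              Bool.false_eq_true]
          · simp only [time_bind, time_op, val_op, val_append, h1, h3, h4, h5, if_true,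
              if_false, Bool.false_eq_true]
            omega
          · exact (childNode_eq_some hN h4).1
          · exact (childNode_eq_some hN h4).2
          · simpa using h5
  · refine ⟨c, ?_, ?_, Or.inl rfl⟩
    · simp [h1]
    · simp only [time_bind, time_op, val_op, h1, if_false, Bool.false_eq_true]
      omega

/-- Expanding a node preserves the invariant and takes a bounded number of steps per action; as
many nodes are added to the queue as to the list of generated nodes. -/
theorem expand_spec (hX : Dominates X a p b M) (hK : nodeBound a p b ≤ X) (ρ : DuplicateRule)
    (dg : ℕ) {N : Node a p} (hN : N.Bounded b) {l : List (Action a p)} (hl : ∀ α ∈ l, α.Fits M)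
    {c : Config a p} (hc : c.Valid b) (hπ : N.plan.length < c.generated.length) :
    (expand ρ dg N l c).val.Valid b ∧
      (expand ρ dg N l c).val.frontier.length + c.generated.length
        = c.frontier.length + (expand ρ dg N l c).val.generated.length ∧
      (expand ρ dg N l c).time ≤ l.length * X ^ (7 * b + 63) + 1 := by
  induction l generalizing c with
  | nil => exact ⟨hc, rfl, by simp [expand, op]⟩
  | cons α l ih =>
    have hl' : ∀ α ∈ l, α.Fits M := fun β hβ => hl β (List.mem_cons_of_mem _ hβ)
    obtain ⟨c₁, hv, ht, h⟩ := expand_cons hX hK ρ dg hN (hl α List.mem_cons_self) l hc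
    rw [hv, List.length_cons, add_mul]
    rcases h with rfl | ⟨N', hN', hN'π, hdup, rfl⟩
    · obtain ⟨h1, h2, h3⟩ := ih hl' hc hπ
      exact ⟨h1, h2, by omega⟩
    · have hv₁ : Config.Valid b ⟨c.frontier ++ [N'], N' :: c.generated⟩ := by
        refine ⟨fun L hL => ?_, fun L hL => ?_, ?_, fun L hL => ?_, ?_⟩
        · rcases List.mem_append.1 hL with hL | hL
          · exact hc.frontier L hL
          · obtain rfl := List.mem_singleton.1 hL
            exact hN'
        · rcases List.mem_cons.1 hL with rfl | hL
          · exact hN'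
          · exact hc.generated L hL
        · refine List.nodup_cons.2 ⟨fun hmem => ?_, hc.nodup⟩
          obtain ⟨L, hL, hLN⟩ := List.mem_map.1 hmem
          simp only [Node.key, Prod.mk.injEq] at hLN
          have := ρ.covers_of_eq hLN.1 hLN.2.1 hLN.2.2
          rw [hdup L hL] at this
          exact Bool.noConfusion this
        · rw [List.length_cons]
          rcases List.mem_append.1 hL with hL | hL
          · exact Nat.lt_succ_of_lt (hc.plan L hL)
          · obtain rfl := List.mem_singleton.1 hL
            rw [hN'π, List.length_cons]
            omega
        · simpa using hc.length
      obtain ⟨h1, h2, h3⟩ := ih hl' hv₁ (Nat.lt_succ_of_lt hπ)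
      refine ⟨h1, ?_, by omega⟩
      simp only [List.length_append, List.length_cons, List.length_nil] at h2
      omega

end Search

/-- From a valid configuration the main loop ends after few iterations: each of them removes a node
from the queue, and only `nodeBound` many nodes are ever generated. -/
theorem exists_loop {T : Task} {b M X : ℕ} (ρ : DuplicateRule) (hX : Dominates X T.a T.p b M)
    (hK : nodeBound T.a T.p b ≤ X) (hT : ∀ α ∈ T.actions, α.Fits M) (hl : T.actions.length ≤ X)
    (hg : T.goal.size ≤ X) (n : ℕ) {c : Config T.a T.p} (hc : c.Valid b)
    (hn : c.frontier.length + nodeBound T.a T.p b ≤ n + c.generated.length) :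
    ∃ r t, Loop T ρ c r t ∧ t ≤ (n + 1) * X ^ (7 * b + 70) := by
  have h2 := hX.two_le
  induction n generalizing c with
  | zero =>
    -- All possible nodes have been generated, so the hypothesis leaves no room for the queue.
    have hf : c.frontier = [] := List.length_eq_zero_iff.1 (by
      have := hc.length_generated_le
      omega)
    have hs : step T ρ c = op (.inl none) := by rw [step, hf]
    refine ⟨none, _, Loop.halt (by rw [hs]; rfl), ?_⟩
    rw [hs, zero_add, one_mul]
    exact Nat.one_le_pow _ _ (by omega)
  | succ n ih =>
    obtain ⟨f, g⟩ := c
    cases f with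
    | nil =>
      refine ⟨none, _, Loop.halt rfl, ?_⟩
      exact (Nat.one_le_pow _ _ (by omega)).trans (Nat.le_mul_of_pos_left _ (by omega))
    | cons N f =>
      have hN := hc.frontier N List.mem_cons_self
      have hπ := hc.plan N List.mem_cons_self
      have hgX := hc.length_generated_le.trans hK
      have hcheck := Fml.within_check h2 (hN.worlds.trans hX.worlds) hg
      have hc' : Config.Valid b ⟨f, g⟩ := ⟨fun L hL => hc.frontier L (List.mem_cons_of_mem _ hL),
        hc.generated, hc.nodup, fun L hL => hc.plan L (List.mem_cons_of_mem _ hL),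
        (Nat.le_succ _).trans hc.length⟩
      obtain ⟨hv, hlen, ht⟩ := expand_spec hX hK ρ T.goal.depth.val hN hT hc' hπ
      have hE : Within X (7 * b + 66) (expand ρ T.goal.depth.val N T.actions ⟨f, g⟩) :=
        loop_le_pow h2 hl (ht.trans (by gcongr; omega))
      have htime : Within X (7 * b + 70) (step T ρ ⟨N :: f, g⟩) :=
        Within.mono h2 (Within.bind h2 hcheck (Within.ite h2
          (Within.bind h2 (Within.reverseOnto h2 (hπ.le.trans hgX)) (Within.op (k := 0) h2 _))
          (Within.bind h2 (Fml.within_depth hg)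
            (Within.bind h2 hE (Within.op (k := 0) h2 _))))) (by omega)
      by_cases hgoal : (T.goal.check N.state).val N.state.pt = true
      · have hs : ∃ r, (step T ρ ⟨N :: f, g⟩).val = .inl r := by simp [step, hgoal]
        obtain ⟨r, hr⟩ := hs
        exact ⟨r, _, Loop.halt hr, htime.trans (Nat.le_mul_of_pos_left _ (by omega))⟩
      · have hs : (step T ρ ⟨N :: f, g⟩).val
            = .inr (expand ρ T.goal.depth.val N T.actions ⟨f, g⟩).val := by
          simp [step, hgoal]
        obtain ⟨r, t, hL, ht'⟩ := ih hv (by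
          simp only [List.length_cons] at hn hlen
          omega)
        refine ⟨r, _, Loop.next hs hL, ?_⟩
        rw [add_mul (n + 1), one_mul, add_comm]
        exact Nat.add_le_add ht' htime

/-- If `X` dominates all data, then the search takes at most polynomially many steps in `X`. -/
theorem exists_boundedGraphSearch {T : Task} {b M X : ℕ} (ρ : DuplicateRule)
    (hX : Dominates X T.a T.p b M) (hK : nodeBound T.a T.p b ≤ X)
    (hT : ∀ α ∈ T.actions, α.Fits M) (hl : T.actions.length ≤ X) (hg : T.goal.size ≤ X)
    (hi : T.init.n ≤ X) : ∃ r t, BoundedGraphSearch ρ T b r t ∧ t ≤ X ^ (7 * b + 73) := by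
  have h2 := hX.two_le
  have hB := initNode_bounded T.init (le_refl b) true []
  have hc : Config.Valid b
      ⟨[(initNode T.init b true []).val], [(initNode T.init b true []).val]⟩ :=
    ⟨by simpa using hB, by simpa using hB, by simp, by simp [plan_initNode], le_rfl⟩
  obtain ⟨r, t, hL, ht⟩ := exists_loop ρ hX hK hT hl hg (nodeBound T.a T.p b) hc
    (by simp [add_comm])
  refine ⟨r, _, ⟨t, hL, rfl⟩, ?_⟩
  have h0 : (initNode T.init b true []).time ≤ X ^ (7 * b + 70) :=
    (within_initNode h2 hX.agents hX.atoms hi hX.bound hX.worlds true []).mono h2 (by omega)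
  have h3 : nodeBound T.a T.p b + 2 ≤ X ^ 3 := by
    have : 2 * 2 * X ≤ X * X * X := Nat.mul_le_mul_right _ (Nat.mul_le_mul h2 h2)
    rw [show X ^ 3 = X * X * X by ring]
    omega
  calc (initNode T.init b true []).time + t
      ≤ (nodeBound T.a T.p b + 2) * X ^ (7 * b + 70) := by
        rw [show nodeBound T.a T.p b + 2 = 1 + (nodeBound T.a T.p b + 1) by omega, add_mul,
          one_mul]
        exact Nat.add_le_add h0 ht
    _ ≤ X ^ 3 * X ^ (7 * b + 70) := Nat.mul_le_mul_right _ h3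
    _ = X ^ (7 * b + 73) := by ring

/-! ### Iterated exponentials -/

theorem tower_mono (k : ℕ) {x y : ℕ} (h : x ≤ y) : tower k x ≤ tower k y := by
  induction k with
  | zero => exact h
  | succ k ih => exact Nat.pow_le_pow_right two_pos ih

theorem tower_le_succ (k x : ℕ) : tower k x ≤ tower (k + 1) x := Nat.lt_two_pow_self.le

theorem tower_le_tower {k l : ℕ} (h : k ≤ l) (x : ℕ) : tower k x ≤ tower l x :=
  monotone_nat_of_le_succ (fun k => tower_le_succ k x) h

theorem le_tower (k x : ℕ) : x ≤ tower k x := tower_le_tower (Nat.zero_le k) x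

/-- Powers of an iterated exponential are absorbed by a power of the argument. -/
theorem tower_pow_le (k : ℕ) {x m : ℕ} (hx : 2 ≤ x) (hm : m ≠ 0) :
    tower k x ^ m ≤ tower k (x ^ m) := by
  induction k with
  | zero => exact le_rfl
  | succ k ih =>
    have hy : 2 ≤ tower k x := hx.trans (le_tower k x)
    obtain ⟨m, rfl⟩ := Nat.exists_eq_succ_of_ne_zero hm
    have h1 : m + 1 ≤ tower k x ^ m :=
      (Nat.succ_le_of_lt Nat.lt_two_pow_self).trans (Nat.pow_le_pow_left hy m)
    rw [tower, ← pow_mul]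
    refine Nat.pow_le_pow_right two_pos (le_trans ?_ ih)
    rw [Nat.succ_eq_add_one, pow_succ, mul_comm]
    exact Nat.mul_le_mul_right _ h1

theorem sigCard_le {a p x : ℕ} (hx : 2 ≤ x) (ha : a ≤ x) (hp : p ≤ x) (h : ℕ) :
    sigCard a p h ≤ tower (h + 1) (x ^ 3 ^ h) := by
  induction h with
  | zero => exact Nat.pow_le_pow_right two_pos (by simpa [tower] using hp)
  | succ h ih =>
    have hx1 : x ≤ x ^ 3 ^ h := Nat.le_self_pow (by positivity) x
    have hxT := hx1.trans (le_tower (h + 1) _)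
    have hT := tower_pow_le (h + 1) (hx.trans hx1) (m := 3) (by omega)
    rw [← pow_mul, ← pow_succ] at hT
    set t := tower (h + 1) (x ^ 3 ^ h)
    rw [sigCard, ← pow_mul, ← pow_add, tower]
    refine Nat.pow_le_pow_right two_pos (le_trans ?_ hT)
    calc p + sigCard a p h * a ≤ t * t + t * t := by
          refine Nat.add_le_add ((hp.trans hxT).trans (Nat.le_mul_self t)) ?_
          exact Nat.mul_le_mul ih (ha.trans hxT)
      _ = t * t * 2 := by ring
      _ ≤ t * t * t := Nat.mul_le_mul_left _ (hx.trans hxT)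
      _ = t ^ 3 := by ring

/-- All summands of `worldBound` are dominated by that of the largest depth, which is below `b`;
this is why `b`-contractions have `b`-fold, and not `(b + 1)`-fold, exponential size. -/
theorem worldBound_le {a p b x : ℕ} (hx : 2 ≤ x) (ha : a ≤ x) (hp : p ≤ x) (hb : b + 1 ≤ x) :
    worldBound a p b ≤ tower b (x ^ 3 ^ b) ^ 2 := by
  have hxT : x ≤ tower b (x ^ 3 ^ b) :=
    (Nat.le_self_pow (by positivity) x).trans (le_tower b _)
  have h1 : ∀ h ∈ Finset.range b, sigCard a p h ≤ tower b (x ^ 3 ^ b) := fun h hh => by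
    have hb := Finset.mem_range.1 hh
    refine (sigCard_le hx ha hp h).trans ((tower_le_tower hb _).trans (tower_mono b ?_))
    exact Nat.pow_le_pow_right (by omega) (Nat.pow_le_pow_right (by omega) hb.le)
  have h2 := Finset.sum_le_card_nsmul _ _ _ h1
  rw [Finset.card_range, smul_eq_mul] at h2
  set t := tower b (x ^ 3 ^ b)
  calc worldBound a p b ≤ b * t + 1 := Nat.add_le_add_right h2 1
    _ ≤ b * t + t := by omega
    _ = (b + 1) * t := by ring
    _ ≤ t * t := Nat.mul_le_mul_right _ (hb.trans hxT)
    _ = t ^ 2 := by ring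

theorem nodeBound_le {a p b u : ℕ} (hu : 2 ≤ u) (ha : a ≤ u) (hp : p ≤ u) (hb : b + 1 ≤ u)
    (hW : worldBound a p b ≤ u) : nodeBound a p b ≤ 2 ^ u ^ 7 := by
  have h2 : ∀ y ≤ u, y + 1 ≤ u * u := fun y hy => by nlinarith
  have hsq : 2 * 2 ≤ u * u := Nat.mul_le_mul hu hu
  calc nodeBound a p b
      ≤ (u * u) * ((2 ^ (u * u)) ^ u * ((2 ^ u) ^ u * u)) * (u * u) := by
        unfold nodeBound
        gcongr
        · exact h2 _ hW
        · exact Nat.one_le_two_pow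
        · exact one_le_two
        · exact Nat.one_le_two_pow
        · exact one_le_two
    _ = u ^ 5 * 2 ^ (u ^ 3 + u ^ 2) := by
        rw [pow_add, ← pow_mul, ← pow_mul]
        ring_nf
    _ ≤ 2 ^ u ^ 5 * 2 ^ (u ^ 3 + u ^ 2) := Nat.mul_le_mul_right _ Nat.lt_two_pow_self.le
    _ = 2 ^ (u ^ 5 + (u ^ 3 + u ^ 2)) := (pow_add _ _ _).symm
    _ ≤ 2 ^ u ^ 7 := by
        refine Nat.pow_le_pow_right two_pos ?_
        have h3 : u ^ 3 ≤ u ^ 5 := Nat.pow_le_pow_right (by omega) (by omega)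
        have h4 : u ^ 2 ≤ u ^ 5 := Nat.pow_le_pow_right (by omega) (by omega)
        have h5 : u ^ 5 * (2 * 2) ≤ u ^ 5 * (u * u) := Nat.mul_le_mul_left _ hsq
        rw [show u ^ 7 = u ^ 5 * (u * u) by ring]
        omega

/-! ### The size of a task -/

theorem Action.fits_size {a p : ℕ} (α : Action a p) : α.Fits α.size := by
  have h : ∀ e, (α.pre e).size + ∑ q, (α.post e q).size ≤ α.size := fun e =>
    (Finset.single_le_sum (f := fun e => (α.pre e).size + ∑ q, (α.post e q).size)
      (fun _ _ => Nat.zero_le _) (Finset.mem_univ e)).trans (Nat.le_add_left _ _)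
  refine ⟨?_, fun e => (Nat.le_add_right _ _).trans (h e), fun e q => ?_⟩
  · unfold Action.size
    omega
  · refine le_trans ?_ ((Nat.le_add_left _ _).trans (h e))
    exact Finset.single_le_sum (f := fun q => (α.post e q).size) (fun _ _ => Nat.zero_le _)
      (Finset.mem_univ q)

theorem Action.one_le_size {a p : ℕ} (α : Action a p) : 1 ≤ α.size :=
  (Nat.one_le_iff_ne_zero.2 fun h => (h ▸ α.pt).elim0).trans α.fits_size.events

theorem Fml.one_le_size {a p : ℕ} (φ : Fml a p) : 1 ≤ φ.size := by
  cases φ <;> simp [Fml.size]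

theorem Task.fits_size (T : Task) : ∀ α ∈ T.actions, α.Fits T.size := fun α hα =>
  α.fits_size.mono <| (List.le_sum_of_mem (List.mem_map_of_mem hα)).trans (by
    unfold Task.size
    omega)

theorem Task.length_actions_le (T : Task) : T.actions.length ≤ T.size := by
  have h : T.actions.length ≤ (T.actions.map Action.size).sum := by
    have := List.length_le_sum_of_one_le (T.actions.map Action.size) fun n hn => by
      obtain ⟨α, -, rfl⟩ := List.mem_map.1 hn
      exact α.one_le_size
    simpa using this
  unfold Task.size
  omega

end DEL

theorem mainTheorem4 (ρ : DEL.DuplicateRule) (b : ℕ) :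
    DEL.RunsInExpTime (b + 1) DEL.Task.size
      (fun T t => ∃ r, DEL.BoundedGraphSearch ρ T b r t) := by
  open DEL in
  refine ⟨(Polynomial.X + Polynomial.C (b + 2)) ^ (3 ^ b * (2 * (7 + (7 * b + 73)))),
    fun T => ?_⟩
  rw [Polynomial.eval_pow, Polynomial.eval_add, Polynomial.eval_X, Polynomial.eval_C]
  -- The summand `b + 2` makes the base of the powers dominate the bound and the constant `2`.
  set x := T.size + (b + 2) with hx
  have hx2 : 2 ≤ x := by omega
  have ha : T.a ≤ T.size := by unfold Task.size; omega
  have hp : T.p ≤ T.size := by unfold Task.size; omega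
  have hi : T.init.n ≤ T.size := by unfold Task.size State.size; omega
  have hg : T.goal.size ≤ T.size := by unfold Task.size; omega
  have hx3 : x ≤ x ^ 3 ^ b := Nat.le_self_pow (by positivity) x
  have hW := worldBound_le (a := T.a) (p := T.p) (b := b) hx2 (by omega) (by omega) (by omega)
  set u := tower b (x ^ 3 ^ b) ^ 2 with hu
  have hxu : x ≤ u := (hx3.trans (le_tower b _)).trans (Nat.le_self_pow (by omega) _)
  have hu2 : 2 ≤ u := hx2.trans hxu
  have huu : u * u + 1 ≤ 2 ^ u ^ 7 := by
    have h7 : u * u ≤ u ^ 7 := by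
      rw [← pow_two]
      exact Nat.pow_le_pow_right (by omega) (by omega)
    exact Nat.succ_le_of_lt (h7.trans_lt Nat.lt_two_pow_self)
  have huX : u ≤ 2 ^ u ^ 7 := (Nat.le_mul_self u).trans ((Nat.le_succ _).trans huu)
  have hD : Dominates (2 ^ u ^ 7) T.a T.p b T.size :=
    { two_le := hu2.trans huX
      agents := by omega
      atoms := by omega
      bound := by omega
      one_le := T.goal.one_le_size.trans hg
      action := by omega
      product := (Nat.succ_le_succ (Nat.mul_le_mul hW (by omega))).trans huu }
  obtain ⟨r, t, h, ht⟩ := exists_boundedGraphSearch ρ hD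
    (nodeBound_le hu2 (by omega) (by omega) (by omega) hW) T.fits_size
    (T.length_actions_le.trans (by omega)) (by omega) (by omega)
  refine ⟨t, ⟨r, h⟩, ht.trans ?_⟩
  rw [← pow_mul, tower]
  refine Nat.pow_le_pow_right two_pos ?_
  calc u ^ 7 * (7 * b + 73)
      ≤ u ^ 7 * u ^ (7 * b + 73) := Nat.mul_le_mul_left _
        (Nat.lt_two_pow_self.le.trans (Nat.pow_le_pow_left hu2 _))
    _ = tower b (x ^ 3 ^ b) ^ (2 * (7 + (7 * b + 73))) := by rw [← pow_add, hu, ← pow_mul]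
    _ ≤ tower b ((x ^ 3 ^ b) ^ (2 * (7 + (7 * b + 73)))) :=
        tower_pow_le b (hx2.trans hx3) (by omega)
    _ = tower b (x ^ (3 ^ b * (2 * (7 + (7 * b + 73))))) := by rw [← pow_mul]
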